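/- Let $d$ be a positive integer and let $\mathcal P_d$ be the set of partitions $\mu=(\mu_1\ge\dots\ge\mu_d\ge 0)$. For $m\in\{1,\dots,d\}$ put $m'=d+1-m$, and for a word $w$ in the alphabet $\{1,\dots,d\}$ let $\omega(w)\in\mathbb N^d$ be its content, i.e. $\omega(w)_k$ is the number of $k$'s in $w$. The reverse Young diagram of $\mu\in\mathcal P_d$ is the right and bottom justified array of boxes whose rows, from bottom to top, have lengths $\mu_1,\mu_2,\dots$; its rows are numbered from bottom to top and its columns from right to left, starting with $1$. A reverse tableau $R$ of shape $\mu$ is a filling of its boxes with elements of $\{1,\dots,d\}$ that weakly increases along rows from left to right and strictly increases along columns from top to bottom. For an entry $a$, let $r(a)$ and $c(a)$ denote its row and column numbers. The factorial Schur function in $x_1,\dots,x_d$ and $(y_i)_{i\ge 1}$ is $$s_\mu(x|y)=\sum_R\ \prod_{a\in R}\bigl(x_a-y_{a'+c(a)-r(a)}\bigr),$$ the sum being over all reverse tableaux $R$ of shape $\mu$. For $\lambda,\mu\in\mathcal P_d$ let $\lambda*\mu$ be the skew diagram obtained by placing the Young diagram of $\lambda$ above and to the right of the reverse Young diagram of $\mu$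 (with no common rows or columns). A skew barred tableau $L$ of shape $\lambda*\mu$ is a filling of the boxes of $\lambda$ with elements of $\{1,\dots,d\}$ and of the boxes of $\mu$ with elements of $\{1,\dots,d\}\cup\{\bar 1,\dots,\bar d\}$ such that the values $|a|$ of the entries $a$ (disregarding bars) weakly increase along rows from left to right and strictly increase along columns from top to bottom. Its unbarred column word $L^u$ is obtained by reading the unbarred entries column by column, from the rightmost column to the leftmost, each column from top to bottom; $L^u_{<a}$ is the portion of $L^u$ read before the entry $a$ is reached. The unbarred content of $L$ is $\omega(L^u)$. Call $L$ an equivariant Littlewood–Richardson skew tableau if $L^u$ is Yamanouchi, i.e. every initial segment of $L^u$ contains at least as many $k$'s as $(k+1)$'s, for $1\le k<d$. For $\nu\in\mathcal P_d$, let $\mathcal{LR}_{\lambda,\mu}^{\nu}$ be the set of equivariant Littlewood–Richardson skew tableaux of shape $\lambda*\mu$ and unbarred content $\nu$. Define $$c_L=\prod_{a\in L,\ a\text{ barred}}\Bigl(y_{|a|'+\omega(L^u_{<a})_{|a|}}-y_{|a|'+c(a)-r(a)}\Bigr),$$ where $r(a),c(a)$ are the row and column numbers of $a$ in the reverse Young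 diagram $\mu$, and the empty product is $1$. **Theorem 2.1.** For all $\lambda,\mu\in\mathcal P_d$ there is a unique finitely supported family $(c_{\lambda,\mu}^{\nu})_{\nu\in\mathcal P_d}$ in $\mathbb C[y_1,y_2,\dots]$ with $$s_\lambda(x|y)\,s_\mu(x|y)=\sum_{\nu\in\mathcal P_d}c_{\lambda,\mu}^{\nu}\,s_\nu(x|y),$$ and for every $\nu\in\mathcal P_d$ $$c_{\lambda,\mu}^{\nu}=\sum_{L\in\mathcal{LR}_{\lambda,\mu}^{\nu}}c_L .$$ -/

import Mathlib

noncomputable section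

namespace FactorialSchur

/-- Partitions `μ₁ ≥ ⋯ ≥ μ_d ≥ 0` with `d` parts; `μ.1 i` is the part `μ_{i+1}`. -/
abbrev DPartition (d : ℕ) : Type := {μ : Fin d → ℕ // Antitone μ}

/-- The boxes of the (ordinary or reverse) Young diagram of `μ`. The box `⟨i, j⟩` lies in row `i + 1`
and column `j + 1`. In an ordinary Young diagram rows are numbered from top to bottom and columns
from left to right; in a reverse Young diagram rows are numbered from bottom to top and columns
from right to left. -/
abbrev Cell {d : ℕ} (μ : DPartition d) : Type := (i : Fin d) × Fin (μ.1 i)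

/-- Row number (starting with `1`). -/
def Cell.row {d : ℕ} {μ : DPartition d} (b : Cell μ) : ℕ := b.1 + 1

/-- Column number (starting with `1`). -/
def Cell.col {d : ℕ} {μ : DPartition d} (b : Cell μ) : ℕ := b.2 + 1

/-- A filling of the ordinary Young diagram (entry `k : Fin d` stands for the integer `k + 1`):
weakly increasing along rows from left to right, strictly increasing along columns from top to
bottom. -/
def IsYoungTableau {d : ℕ} {lam : DPartition d} (T : Cell lam → Fin d) : Prop :=
  (∀ b b' : Cell lam, b.row = b'.row → b.col < b'.col → T b ≤ T b') ∧
  (∀ b b' : Cell lam, b.col = b'.col → b.row < b'.row → T b < T b')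

/-- A filling of the reverse Young diagram (entry `k : Fin d` stands for the integer `k + 1`):
weakly increasing along rows from left to right (decreasing column number), strictly increasing
along columns from top to bottom (decreasing row number). -/
def IsReverseTableau {d : ℕ} {μ : DPartition d} (T : Cell μ → Fin d) : Prop :=
  (∀ b b' : Cell μ, b.row = b'.row → b'.col < b.col → T b ≤ T b') ∧
  (∀ b b' : Cell μ, b.col = b'.col → b'.row < b.row → T b < T b')

/-- `a' = d + 1 - a` for the integer `a = k + 1` represented by `k : Fin d`. -/
def prime {d : ℕ} (k : Fin d) : ℕ := d + 1 - (k + 1)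

/-- The ring `ℂ[y₁, y₂, …]`. -/
abbrev YRing : Type := MvPolynomial ℕ+ ℂ

/-- The variable `y_k`, for `k ≥ 1`; only positive indices occur
below (see `IsReverseTableau.row_lt`). -/
def y (k : ℕ) : YRing := MvPolynomial.X k.toPNat'

/-- In a reverse tableau `a' + c(a) - r(a) ≥ 1`, so that this index involves no truncated
subtraction. -/
theorem IsReverseTableau.row_lt {d : ℕ} {μ : DPartition d} {T : Cell μ → Fin d}
    (hT : IsReverseTableau T) (b : Cell μ) : b.row < prime (T b) + b.col := by
  have key : ∀ n : ℕ, ∀ (h : n < d) (j : Fin (μ.1 ⟨n, h⟩)), (T ⟨⟨n, h⟩, j⟩ : ℕ) + n < d := by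
    intro n
    induction n with
    | zero => intro h j; simp
    | succ n ih =>
      intro h j
      have hle : μ.1 ⟨n + 1, h⟩ ≤ μ.1 ⟨n, by omega⟩ := μ.2 (by simp [Fin.le_def])
      have h1 := ih (by omega) ⟨j, lt_of_lt_of_le j.2 hle⟩
      have h2 := hT.2 ⟨⟨n + 1, h⟩, j⟩ ⟨⟨n, by omega⟩, ⟨j, lt_of_lt_of_le j.2 hle⟩⟩
        (by simp [Cell.col]) (by simp [Cell.row])
      rw [Fin.lt_def] at h2
      omega
  obtain ⟨⟨n, h⟩, j⟩ := b
  have := key n h j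
  simp only [Cell.row, Cell.col, prime]
  omega

open Classical in
/-- The factorial Schur function
`s_μ(x|y) = ∑_R ∏_{a ∈ R} (x_a - y_{a' + c(a) - r(a)})`, summed over the reverse tableaux `R` of
shape `μ`, as an element of `ℂ[y][x₁, …, x_d]`. -/
def factorialSchur {d : ℕ} (μ : DPartition d) : MvPolynomial (Fin d) YRing :=
  ∑ R : Cell μ → Fin d with IsReverseTableau R,
    ∏ b : Cell μ,
      (MvPolynomial.X (R b) - MvPolynomial.C (y (prime (R b) + b.col - b.row)))

/-- `c` is a (finitely supported) family of coefficients in `ℂ[y]` with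
`s_λ(x|y) s_μ(x|y) = ∑_ν c_ν s_ν(x|y)`. -/
def IsProductExpansion {d : ℕ} (lam μ : DPartition d) (c : DPartition d →₀ YRing) : Prop :=
  factorialSchur lam * factorialSchur μ = c.sum fun ν a => a • factorialSchur ν

/-- The boxes of the skew diagram `λ * μ`: the Young diagram `λ` placed above and to the right of
the reverse Young diagram `μ` (so that the two share no row and no column). -/
abbrev Box {d : ℕ} (lam μ : DPartition d) : Type := Cell lam ⊕ Cell μ

/-- A filling of `λ * μ` by possibly barred integers: the entry `(k, β)` has value `k + 1`, and is
barred if and only if `β = true`. -/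
abbrev Filling {d : ℕ} (lam μ : DPartition d) : Type := Box lam μ → Fin d × Bool

/-- Skew barred tableaux of shape `λ * μ`: the boxes of `λ` are unbarred, and the values weakly
increase along rows and strictly increase along columns. -/
def IsSkewBarredTableau {d : ℕ} {lam μ : DPartition d} (L : Filling lam μ) : Prop :=
  (∀ b : Cell lam, (L (Sum.inl b)).2 = false) ∧
  IsYoungTableau (fun b : Cell lam => (L (Sum.inl b)).1) ∧
  IsReverseTableau (fun b : Cell μ => (L (Sum.inr b)).1)

/-- The boxes of the diagram of `μ` with second coordinate `j`, by increasing first coordinate. -/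
def columnCells {d : ℕ} (μ : DPartition d) (j : ℕ) : List (Cell μ) :=
  (List.finRange d).filterMap fun i => if h : j < μ.1 i then some ⟨i, ⟨j, h⟩⟩ else none

/-- The number of columns of the diagram of `μ`. -/
def numColumns {d : ℕ} (μ : DPartition d) : ℕ := Finset.univ.sup μ.1

/-- All boxes of `λ * μ` in reading order: columns from right to left, each read from top to bottom.
Thus the columns of `λ` come first, with decreasing column numbers and increasing row numbers; then
those of `μ`, with increasing column numbers and decreasing row numbers. -/
def readingOrder {d : ℕ} (lam μ : DPartition d) : List (Box lam μ) :=
  ((List.range (numColumns lam)).reverse.flatMap fun j => (columnCells lam j).map Sum.inl) ++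
  ((List.range (numColumns μ)).flatMap fun j => (columnCells μ j).reverse.map Sum.inr)

/-- The sequence of the values of the unbarred entries of `L` in a list of boxes. -/
def unbarredEntries {d : ℕ} {lam μ : DPartition d} (L : Filling lam μ) (bs : List (Box lam μ)) :
    List (Fin d) :=
  (bs.filter fun b => (L b).2 = false).map fun b => (L b).1

/-- The unbarred column word `L^u`. -/
def unbarredWord {d : ℕ} {lam μ : DPartition d} (L : Filling lam μ) : List (Fin d) :=
  unbarredEntries L (readingOrder lam μ)

/-- The portion `L^u_{<a}` of the unbarred column word that is read before reaching the box `a`. -/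
def unbarredWordBefore {d : ℕ} {lam μ : DPartition d} (L : Filling lam μ) (a : Box lam μ) :
    List (Fin d) :=
  unbarredEntries L ((readingOrder lam μ).takeWhile fun b => b ≠ a)

/-- The content `ω(w)` of a word: `ω(w)_k` is the number of `k`'s in `w`. -/
def content {d : ℕ} (w : List (Fin d)) : Fin d → ℕ := fun k => w.count k

/-- Yamanouchi words: every initial segment contains at least as many `k`'s as `k + 1`'s. -/
def IsYamanouchi {d : ℕ} (w : List (Fin d)) : Prop :=
  ∀ v : List (Fin d), v <+: w → ∀ k l : Fin d, (l : ℕ) = k + 1 → content v l ≤ content v k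

/-- Equivariant Littlewood-Richardson skew tableaux of shape `λ * μ` and unbarred content `ν`. -/
def IsEquivariantLR {d : ℕ} {lam μ : DPartition d} (ν : DPartition d) (L : Filling lam μ) : Prop :=
  IsSkewBarredTableau L ∧ IsYamanouchi (unbarredWord L) ∧ content (unbarredWord L) = ν.1

/-- `c_L = ∏ (y_{|a|' + ω(L^u_{<a})_{|a|}} - y_{|a|' + c(a) - r(a)})`, the product over the barred
entries `a` of `L` (all of which lie in `μ`), with `c(a)` and `r(a)` the column and row number of
the box in the reverse Young diagram `μ`. -/
def weight {d : ℕ} {lam μ : DPartition d} (L : Filling lam μ) : YRing :=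
  ∏ b : Cell μ with (L (Sum.inr b)).2 = true,
    (y (prime (L (Sum.inr b)).1 +
          content (unbarredWordBefore L (Sum.inr b)) (L (Sum.inr b)).1) -
      y (prime (L (Sum.inr b)).1 + b.col - b.row))

end FactorialSchur

end

/-! Write a_β for the antisymmetrization of the product over k of (x_k - y_1)⋯(x_k - y_{β_k}), and δ
= (d-1, …, 0). The core is an expansion of a_{λ+δ} s_μ into alternants a_{ν+δ} with coefficients the
sums of the c_L. For λ = 0 a single term survives and gives the bialternant formula a_δ s_μ =
a_{μ+δ}. Hence the general case computes a_δ s_λ s_μ, and a_δ ≠ 0 cancels. Uniqueness is the linear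
independence of the a_{ν+δ}: at x_k = y_{ν_k+δ_k+1} the alternant a_{ν'+δ} vanishes unless ν' ≤ ν,
and a_{ν+δ} does not.

For the expansion, s_μ is a sum over sequences of columns, peeled off from right to left. The index
a' + c(a) - r(a) depends only on the column number and on the set of entries in the column. If α is
the content reached so far, each linear factor splits as (x_a - y_{a'+α_a}) + (y_{a'+α_a} -
y_{a'+c(a)-r(a)}). The first summand raises the exponent of x_a by one (an unbarred entry), the
second is the scalar of a barred entry (`facMono_mul_columnWeight`). If the new content is not a
partition, its sum with δ has equal entries at two adjacent places k, l = k+1, and l lies in the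
column just read. The generating function of all columns further left is then symmetric in x_k, x_l
(`swapVar_columnSum`), so antisymmetrization kills the term (`alternate_eq_zero_of_not_antitone`).
This symmetry carries the cancellation; it is proved by induction on the number of columns, pairing
each column with its image under k ↔ l.

The surviving terms are barred tableaux whose content, added to λ, is a partition after every
column. As columns strictly increase, this is the Yamanouchi condition relative to λ, and in L the
part of shape λ is forced: every entry is its row number (`yamanouchi_left_iff`). -/

namespace FactorialSchur

/-! ### Columns as subsets, compared by dominance -/

/-- The number of elements of `D` that are at least `t`. -/
def countGE {d : ℕ} (D : Finset (Fin d)) (t : ℕ) : ℕ := (D.filter fun a : Fin d => t ≤ (a : ℕ)).card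

/-- `D` can be the column to the left of the column `C` in a reverse tableau. -/
def ColLE {d : ℕ} (D C : Finset (Fin d)) : Prop := ∀ t, countGE D t ≤ countGE C t

/-- The number of elements greater than `a` missing from `D`. -/
def gap {d : ℕ} (D : Finset (Fin d)) (a : Fin d) : ℕ :=
  (Finset.univ.filter fun b => a < b ∧ b ∉ D).card

/-- The linear factor of an entry `a` of the column `D` with (zero-based) column index `j`. -/
noncomputable def entryFactor {d : ℕ} (j : ℕ) (D : Finset (Fin d)) (a : Fin d) :
    MvPolynomial (Fin d) YRing :=
  MvPolynomial.X a - MvPolynomial.C (y (j + 1 + gap D a))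

/-- The weight of the column `D` with (zero-based) column index `j`. -/
noncomputable def columnWeight {d : ℕ} (j : ℕ) (D : Finset (Fin d)) :
    MvPolynomial (Fin d) YRing := ∏ a ∈ D, entryFactor j D a

open Classical in
/-- The columns of height `h` that can stand to the left of `C`. -/
noncomputable def nextColumns {d : ℕ} (h : ℕ) (C : Finset (Fin d)) : Finset (Finset (Fin d)) :=
  Finset.univ.filter fun D => D.card = h ∧ ColLE D C

/-- The generating function of sequences of `n` columns, with column indices starting at `j`, to
the left of the column `C`. -/
noncomputable def columnSum {d : ℕ} (h : ℕ → ℕ) :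
    ℕ → ℕ → Finset (Fin d) → MvPolynomial (Fin d) YRing
  | 0, _, _ => 1
  | n + 1, j, C => ∑ D ∈ nextColumns (h j) C, columnWeight j D * columnSum h n (j + 1) D

variable {d : ℕ}

theorem mem_nextColumns {h : ℕ} {C D : Finset (Fin d)} :
    D ∈ nextColumns h C ↔ D.card = h ∧ ColLE D C := by
  simp [nextColumns]

theorem countGE_eq_succ (D : Finset (Fin d)) (k : Fin d) :
    countGE D k = countGE D (k + 1) + if k ∈ D then 1 else 0 := by
  unfold countGE
  have h1 : (D.filter fun a : Fin d => (k : ℕ) ≤ (a : ℕ)) =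
      (D.filter fun a : Fin d => (k : ℕ) + 1 ≤ (a : ℕ)) ∪ (D.filter fun a : Fin d => a = k) := by
    ext a
    simp only [Finset.mem_filter, Finset.mem_union, Fin.ext_iff, ← and_or_left]
    exact and_congr_right fun _ => by omega
  rw [h1, Finset.card_union_of_disjoint, Finset.filter_eq']
  · split_ifs <;> simp
  · rw [Finset.disjoint_filter]
    rintro a - h rfl
    omega

/-- The d - 1 - a values above `a` either lie in `D` or are missing from it. This turns every
question about `gap` into one about `countGE`. -/
theorem gap_add_countGE (D : Finset (Fin d)) (a : Fin d) :
    gap D a + countGE D (a + 1) + a + 1 = d := by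
  unfold gap countGE
  have h2 : (D.filter fun b : Fin d => (a : ℕ) + 1 ≤ (b : ℕ)) =
      Finset.univ.filter fun b => a < b ∧ ¬ b ∉ D := by
    ext b
    simp only [Finset.mem_filter, Finset.mem_univ, true_and, not_not, Fin.lt_def,
      Nat.succ_le_iff, and_comm]
  have h3 : (Finset.univ.filter fun b => a < b) = Finset.Ioi a := by ext; simp
  rw [h2, ← Finset.filter_filter, ← Finset.filter_filter,
    Finset.card_filter_add_card_filter_not, h3, Fin.card_Ioi]
  omega

/-! ### Symmetry in two adjacent variables -/

section Swap

variable {k l : Fin d}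

/-- Exchange `k` and `l` in a set. -/
def swapSet (k l : Fin d) (D : Finset (Fin d)) : Finset (Fin d) :=
  D.map (Equiv.swap k l).toEmbedding

theorem mem_swapSet {D : Finset (Fin d)} {a : Fin d} :
    a ∈ swapSet k l D ↔ Equiv.swap k l a ∈ D := by
  unfold swapSet
  constructor
  · intro h
    obtain ⟨b, hb, rfl⟩ := Finset.mem_map.1 h
    simpa using hb
  · intro h
    exact Finset.mem_map.2 ⟨_, h, by simp⟩

theorem swapSet_swapSet (D : Finset (Fin d)) : swapSet k l (swapSet k l D) = D := by
  ext a; simp [mem_swapSet]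

theorem card_swapSet (D : Finset (Fin d)) : (swapSet k l D).card = D.card := by
  simp [swapSet]

theorem swapSet_of_iff {D : Finset (Fin d)} (h : k ∈ D ↔ l ∈ D) : swapSet k l D = D := by
  ext a
  rw [mem_swapSet]
  by_cases hk : a = k
  · subst hk; simp [h]
  by_cases hl : a = l
  · subst hl; simp [h]
  rw [Equiv.swap_apply_of_ne_of_ne hk hl]

theorem countGE_swapSet (hl : (l : ℕ) = k + 1) (D : Finset (Fin d)) {t : ℕ} (ht : t ≠ l) :
    countGE (swapSet k l D) t = countGE D t := by
  unfold countGE swapSet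
  rw [Finset.filter_map, Finset.card_map]
  congr 1
  apply Finset.filter_congr
  intro a _
  simp only [Function.comp, Equiv.coe_toEmbedding]
  by_cases hk : a = k
  · subst hk; simp; omega
  by_cases hl : a = l
  · subst hl; simp; omega
  rw [Equiv.swap_apply_of_ne_of_ne hk hl]

theorem gap_swapSet (hl : (l : ℕ) = k + 1) (D : Finset (Fin d)) {a : Fin d} (ha : a ≠ k) :
    gap (swapSet k l D) a = gap D a := by
  have h1 := gap_add_countGE D a
  have h2 := gap_add_countGE (swapSet k l D) a
  rw [countGE_swapSet hl D (by rw [hl]; intro h; exact ha (Fin.ext (by omega)))] at h2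
  omega

theorem gap_eq_succ (hl : (l : ℕ) = k + 1) (D : Finset (Fin d)) :
    gap D k = gap D l + if l ∈ D then 0 else 1 := by
  have h1 := gap_add_countGE D k
  have h2 := gap_add_countGE D l
  have h3 := countGE_eq_succ D l
  rw [← hl] at h1
  split_ifs at * <;> omega

/-- Only the count at `l` can change. If `k ∉ C`, the bound at `k` already bounds it; if `k` and `l`
are both in `C`, the bound at `l + 1` does, with one added on the side of `C`. -/
theorem colLE_swapSet (hl : (l : ℕ) = k + 1) {C D : Finset (Fin d)} (hC : k ∈ C → l ∈ C)
    (h : ColLE D C) : ColLE (swapSet k l D) C := by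
  intro t
  by_cases ht : t = l
  · subst ht
    have h1 := countGE_eq_succ (swapSet k l D) k
    have h2 := countGE_eq_succ (swapSet k l D) l
    rw [countGE_swapSet hl D (t := k) (by omega), ← hl] at h1
    rw [countGE_swapSet hl D (t := l + 1) (by omega)] at h2
    have h3 := countGE_eq_succ C k
    have h4 := countGE_eq_succ C l
    rw [← hl] at h3
    have h5 := h k
    have h6 := h (l + 1)
    by_cases hk : k ∈ C
    · simp only [hk, hC hk, if_true] at h3 h4
      split_ifs at h2 <;> omega
    · simp only [hk, if_false] at h3
      omega
  · rw [countGE_swapSet hl D ht]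
    exact h t

/-- Replacing `k` by `l` in `C` raises the count at `l` by one and changes no other, so the
additional columns are those attaining equality there. -/
theorem colLE_of_swapSet_iff (hl : (l : ℕ) = k + 1) {C D : Finset (Fin d)} (hk : k ∈ C)
    (hlC : l ∉ C) :
    ColLE D C ↔ ColLE D (swapSet k l C) ∧ countGE D l ≠ countGE (swapSet k l C) l := by
  have h1 := countGE_eq_succ (swapSet k l C) k
  rw [← hl, if_neg (by simpa [mem_swapSet] using hlC), countGE_swapSet hl C (by omega)] at h1
  have h2 := countGE_eq_succ C k
  rw [← hl, if_pos hk] at h2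
  constructor
  · intro h
    refine ⟨fun t => ?_, ?_⟩
    · by_cases ht : t = l
      · subst ht
        have := h l
        omega
      · rw [countGE_swapSet hl C ht]; exact h t
    · have := h l
      omega
  · rintro ⟨h, h'⟩ t
    by_cases ht : t = l
    · subst ht
      have := h l
      omega
    · rw [← countGE_swapSet hl C ht]; exact h t

/-- The columns allowed to the left of `swapSet k l C` but not to the left of `C`. -/
theorem tight_column (hl : (l : ℕ) = k + 1) {C D : Finset (Fin d)} (hk : k ∈ C)
    (hlC : l ∉ C) (h : ColLE D (swapSet k l C))
    (h' : countGE D l = countGE (swapSet k l C) l) :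
    k ∉ D ∧ l ∈ D ∧ gap D l + 1 = gap C k := by
  have h1 := countGE_eq_succ (swapSet k l C) k
  rw [← hl, if_neg (by simpa [mem_swapSet] using hlC)] at h1
  have h2 := countGE_eq_succ (swapSet k l C) l
  rw [if_pos (by simpa [mem_swapSet] using hk)] at h2
  have h3 := countGE_eq_succ D k
  have h4 := countGE_eq_succ D l
  rw [← hl] at h3
  have h5 := h k
  have h6 := h (l + 1)
  have hkD : k ∉ D := by
    intro hkD
    rw [if_pos hkD] at h3
    omega
  have hlD : l ∈ D := by
    by_contra hlD
    rw [if_neg hlD] at h4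
    omega
  refine ⟨hkD, hlD, ?_⟩
  rw [gap_eq_succ hl C, if_neg hlC, ← gap_swapSet hl C (a := l) (by rintro rfl; omega)]
  have h7 := gap_add_countGE (swapSet k l C) l
  have h8 := gap_add_countGE D l
  rw [if_pos hlD] at h4
  omega

/-- The automorphism exchanging two variables. -/
noncomputable abbrev swapVar (k l : Fin d) :
    MvPolynomial (Fin d) YRing →ₐ[YRing] MvPolynomial (Fin d) YRing :=
  MvPolynomial.rename (Equiv.swap k l)

theorem swapVar_entryFactor (j : ℕ) (D : Finset (Fin d)) (a : Fin d) :
    swapVar k l (entryFactor j D a) =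
      MvPolynomial.X (Equiv.swap k l a) - MvPolynomial.C (y (j + 1 + gap D a)) := by
  simp [entryFactor]

theorem swapVar_entryFactor_of_ne {a : Fin d} (j : ℕ) (D : Finset (Fin d)) (hk : a ≠ k)
    (hl : a ≠ l) : swapVar k l (entryFactor j D a) = entryFactor j D a := by
  rw [swapVar_entryFactor, Equiv.swap_apply_of_ne_of_ne hk hl, entryFactor]

theorem swapVar_columnWeight (hl : (l : ℕ) = k + 1) (j : ℕ) {D : Finset (Fin d)}
    (h : k ∈ D ↔ l ∈ D) : swapVar k l (columnWeight j D) = columnWeight j D := by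
  rw [columnWeight, map_prod]
  refine Finset.prod_bij (fun a _ => Equiv.swap k l a) ?_ ?_ ?_ ?_
  · intro a ha
    rw [← mem_swapSet, swapSet_of_iff h]
    exact ha
  · intro a _ b _ hab
    exact (Equiv.swap k l).injective hab
  · intro b hb
    refine ⟨Equiv.swap k l b, ?_, by simp⟩
    rw [← mem_swapSet, swapSet_of_iff h]
    exact hb
  · intro a ha
    rw [swapVar_entryFactor, entryFactor]
    by_cases hk : a = k
    · subst hk
      rw [Equiv.swap_apply_left, gap_eq_succ hl D, if_pos (h.1 ha), add_zero]
    by_cases hl' : a = l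
    · subst hl'
      rw [Equiv.swap_apply_right, gap_eq_succ hl D, if_pos ha, add_zero]
    rw [Equiv.swap_apply_of_ne_of_ne hk hl']

/-- The part of the weight of a column not involving `k` and `l`. -/
noncomputable def restWeight (k l : Fin d) (j : ℕ) (D : Finset (Fin d)) :
    MvPolynomial (Fin d) YRing := ∏ a ∈ (D.erase k).erase l, entryFactor j D a

theorem swapVar_restWeight (j : ℕ) (D : Finset (Fin d)) :
    swapVar k l (restWeight k l j D) = restWeight k l j D := by
  rw [restWeight, map_prod]
  refine Finset.prod_congr rfl fun a ha => ?_
  simp only [Finset.mem_erase] at ha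
  exact swapVar_entryFactor_of_ne j D ha.2.1 ha.1

theorem columnWeight_of_left (j : ℕ) {D : Finset (Fin d)} (hk : k ∈ D) (hl : l ∉ D) :
    columnWeight j D = entryFactor j D k * restWeight k l j D := by
  rw [columnWeight, restWeight, Finset.erase_eq_of_notMem (a := l) (by simp [hl]),
    Finset.mul_prod_erase _ _ hk]

theorem columnWeight_of_right (j : ℕ) {D : Finset (Fin d)} (hk : k ∉ D) (hl : l ∈ D) :
    columnWeight j D = entryFactor j D l * restWeight k l j D := by
  rw [columnWeight, restWeight, Finset.erase_eq_of_notMem (a := k) hk,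
    Finset.mul_prod_erase _ _ hl]

theorem restWeight_swapSet (hl : (l : ℕ) = k + 1) (j : ℕ) (D : Finset (Fin d)) :
    restWeight k l j (swapSet k l D) = restWeight k l j D := by
  rw [restWeight, restWeight]
  have h : ((swapSet k l D).erase k).erase l = (D.erase k).erase l := by
    ext a
    simp only [Finset.mem_erase, mem_swapSet]
    by_cases hk : a = k
    · simp [hk]
    by_cases hl : a = l
    · simp [hl]
    rw [Equiv.swap_apply_of_ne_of_ne hk hl]
  rw [h]
  refine Finset.prod_congr rfl fun a ha => ?_
  simp only [Finset.mem_erase] at ha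
  rw [entryFactor, entryFactor, gap_swapSet hl D ha.2.1]

variable {h : ℕ → ℕ} {n : ℕ}

/-- The generating functions for two columns differing by the exchange of `k` and `l`. -/
theorem columnSum_sub (hl : (l : ℕ) = k + 1)
    (ih : ∀ j, ∀ C : Finset (Fin d), l ∈ C →
      swapVar k l (columnSum h (n - 1) j C) = columnSum h (n - 1) j C)
    (j : ℕ) {C : Finset (Fin d)} (hkC : k ∈ C) (hlC : l ∉ C) :
    ∃ M, swapVar k l M = M ∧ columnSum h n (j + 1) C = columnSum h n (j + 1) (swapSet k l C) -
      (MvPolynomial.X l - MvPolynomial.C (y (j + 1 + gap C k))) * M := by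
  classical
  cases n with
  | zero => exact ⟨0, by simp, by simp [columnSum]⟩
  | succ n =>
    set E := (nextColumns (h (j + 1)) (swapSet k l C)).filter
      fun D => countGE D l = countGE (swapSet k l C) l with hE
    have hE' : ∀ D ∈ E, k ∉ D ∧ l ∈ D ∧ gap D l + 1 = gap C k := by
      intro D hD
      rw [hE, Finset.mem_filter, mem_nextColumns] at hD
      exact tight_column hl hkC hlC hD.1.2 hD.2
    refine ⟨∑ D ∈ E, restWeight k l (j + 1) D * columnSum h n (j + 1 + 1) D, ?_, ?_⟩
    · rw [map_sum]
      refine Finset.sum_congr rfl fun D hD => ?_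
      rw [map_mul, swapVar_restWeight]
      exact congrArg _ (ih _ _ (hE' D hD).2.1)
    · have h1 : nextColumns (h (j + 1)) C = (nextColumns (h (j + 1)) (swapSet k l C)).filter
          fun D => ¬ countGE D l = countGE (swapSet k l C) l := by
        ext D
        rw [Finset.mem_filter, mem_nextColumns, mem_nextColumns,
          colLE_of_swapSet_iff hl hkC hlC, and_assoc]
      -- The additional columns all contain `l` and share the same factor for it: moving one column
      -- to the left raises the index by one, which offsets `gap D l + 1 = gap C k`.
      have h2 : (MvPolynomial.X l - MvPolynomial.C (y (j + 1 + gap C k))) *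
          ∑ D ∈ E, restWeight k l (j + 1) D * columnSum h n (j + 1 + 1) D =
          ∑ D ∈ E, columnWeight (j + 1) D * columnSum h n (j + 1 + 1) D := by
        rw [Finset.mul_sum]
        refine Finset.sum_congr rfl fun D hD => ?_
        obtain ⟨hk, hl', hg⟩ := hE' D hD
        rw [columnWeight_of_right _ hk hl', entryFactor, ← hg, mul_assoc,
          show j + 1 + (gap D l + 1) = j + 1 + 1 + gap D l by omega]
      rw [h2, eq_sub_iff_add_eq, columnSum, columnSum, h1, hE, add_comm]
      exact Finset.sum_filter_add_sum_filter_not _ _ _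

/-- Suppose `k ∈ D`, `l ∉ D`. Let Q be the sum to the left of the swapped column, R the common rest
of the weights, u = `y (j + 1 + gap D k)` and v = `y (j + 1 + gap D l)`. By `columnSum_sub` the pair
contributes R((x_k - u)(Q - (x_l - u)M) + (x_l - v)Q) = R((x_k + x_l - u - v)Q - (x_k - u)(x_l -
u)M), and Q, R, M are symmetric. -/
theorem swapVar_pair (hl : (l : ℕ) = k + 1)
    (ih : ∀ j, ∀ C : Finset (Fin d), (k ∈ C → l ∈ C) →
      swapVar k l (columnSum h n j C) = columnSum h n j C)
    (ih' : ∀ j, ∀ C : Finset (Fin d), l ∈ C →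
      swapVar k l (columnSum h (n - 1) j C) = columnSum h (n - 1) j C)
    (j : ℕ) (D : Finset (Fin d)) :
    swapVar k l (columnWeight j D * columnSum h n (j + 1) D +
        columnWeight j (swapSet k l D) * columnSum h n (j + 1) (swapSet k l D)) =
      columnWeight j D * columnSum h n (j + 1) D +
        columnWeight j (swapSet k l D) * columnSum h n (j + 1) (swapSet k l D) := by
  by_cases hD : k ∈ D ↔ l ∈ D
  · rw [swapSet_of_iff hD, map_add, map_mul, swapVar_columnWeight hl j hD, ih _ _ hD.1]
  have main : ∀ D : Finset (Fin d), k ∈ D → l ∉ D →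
      swapVar k l (columnWeight j D * columnSum h n (j + 1) D +
        columnWeight j (swapSet k l D) * columnSum h n (j + 1) (swapSet k l D)) =
      columnWeight j D * columnSum h n (j + 1) D +
        columnWeight j (swapSet k l D) * columnSum h n (j + 1) (swapSet k l D) := by
    intro D hk hl'
    obtain ⟨M, hM, hsub⟩ := columnSum_sub hl ih' j hk hl'
    have hQ := ih (j + 1) (swapSet k l D) (fun h => absurd h (by simpa [mem_swapSet] using hl'))
    rw [hsub, columnWeight_of_left j hk hl', columnWeight_of_right j (k := k) (l := l)
      (D := swapSet k l D) (by simpa [mem_swapSet] using hl') (by simpa [mem_swapSet] using hk),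
      restWeight_swapSet hl]
    simp only [map_add, map_mul, map_sub, hM, hQ, swapVar_restWeight, entryFactor,
      MvPolynomial.rename_X, MvPolynomial.rename_C, Equiv.swap_apply_left, Equiv.swap_apply_right]
    ring
  by_cases hk : k ∈ D
  · exact main D hk (fun h => hD (by simp [hk, h]))
  · have hl' : l ∈ D := by
      by_contra hl'
      exact hD (by simp [hk, hl'])
    have := main (swapSet k l D) (by simpa [mem_swapSet] using hl') (by simpa [mem_swapSet] using hk)
    rw [swapSet_swapSet] at this
    rw [add_comm]
    exact this

/-- Symmetry of the generating function of the columns to the left of `C` in two consecutive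
variables. -/
theorem swapVar_columnSum (hl : (l : ℕ) = k + 1) (n : ℕ) : ∀ j, ∀ C : Finset (Fin d),
    (k ∈ C → l ∈ C) → swapVar k l (columnSum h n j C) = columnSum h n j C := by
  induction n using Nat.strong_induction_on with
  | _ n ih =>
    intro j C hC
    cases n with
    | zero => simp [columnSum]
    | succ n =>
      have key := swapVar_pair (h := h) hl (ih n (by omega))
        (fun j C hC => ih (n - 1) (by omega) j C fun _ => hC) j
      have hbij : ∑ D ∈ nextColumns (h j) C,
          columnWeight j (swapSet k l D) * columnSum h n (j + 1) (swapSet k l D) =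
          columnSum h (n + 1) j C := by
        refine Finset.sum_nbij' (swapSet k l) (swapSet k l) ?_ ?_ ?_ ?_ ?_
        · intro D hD
          rw [mem_nextColumns] at hD ⊢
          exact ⟨by rw [card_swapSet]; exact hD.1, colLE_swapSet hl hC hD.2⟩
        · intro D hD
          rw [mem_nextColumns] at hD ⊢
          exact ⟨by rw [card_swapSet]; exact hD.1, colLE_swapSet hl hC hD.2⟩
        · intro D _; exact swapSet_swapSet D
        · intro D _; exact swapSet_swapSet D
        · intro D _; rfl
      -- Summing over all `D` counts each column twice, once as itself and once as a partner; the
      -- factor 2 is cancelled at the end.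
      have h2 : columnSum h (n + 1) j C + columnSum h (n + 1) j C =
          ∑ D ∈ nextColumns (h j) C, (columnWeight j D * columnSum h n (j + 1) D +
            columnWeight j (swapSet k l D) * columnSum h n (j + 1) (swapSet k l D)) := by
        rw [Finset.sum_add_distrib, hbij]
        rfl
      have h3 := congrArg (swapVar k l) h2
      rw [map_sum, Finset.sum_congr rfl fun D _ => key D, ← h2, map_add, ← two_mul,
        ← two_mul] at h3
      exact mul_left_cancel₀ two_ne_zero h3

end Swap

end FactorialSchur

namespace FactorialSchur

/-! ### Weighted sums over paths -/

section Transfer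

variable {S X R M : Type*} [Fintype X] [CommSemiring R] [AddCommMonoid M] [Module R M]

/-- The weighted sum over all sequences of `n` steps from the state `s`. -/
def transferSum (w : ℕ → S → X → R) (upd : S → X → S) (φ : S → M) : ℕ → ℕ → S → M
  | 0, _, s => φ s
  | n + 1, j, s => ∑ x, w j s x • transferSum w upd φ n (j + 1) (upd s x)

/-- Unfolds the recursion into one sum over whole paths, the form in which it can be compared with a
sum over tableaux. -/
theorem transferSum_eq_sum (w : ℕ → S → X → R) (upd : S → X → S) (φ : S → M) (n : ℕ) :
    ∀ j s, transferSum w upd φ n j s = ∑ p : Fin n → X,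
      (∏ i : Fin n, w (j + i) (((List.ofFn p).take i).foldl upd s) (p i)) •
        φ ((List.ofFn p).foldl upd s) := by
  induction n with
  | zero => intro j s; simp [transferSum]
  | succ n ih =>
    intro j s
    rw [transferSum, ← (Fin.consEquiv fun _ => X).sum_comp, Fintype.sum_prod_type]
    refine Finset.sum_congr rfl fun x _ => ?_
    rw [ih, Finset.smul_sum]
    refine Finset.sum_congr rfl fun p _ => ?_
    simp only [Fin.consEquiv_apply, Fin.prod_univ_succ, Fin.cons_zero, Fin.cons_succ,
      List.ofFn_succ, Fin.val_zero, Fin.val_succ, List.take_zero, List.take_succ_cons,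
      List.foldl_nil, List.foldl_cons, mul_smul, add_zero]
    simp only [add_assoc, add_comm 1]

end Transfer

variable {d : ℕ}

/-! ### Alternants and their expansion column by column -/

/-- The factorial power `(x_k - y_1) ⋯ (x_k - y_m)`. -/
noncomputable def facPow (k : Fin d) (m : ℕ) : MvPolynomial (Fin d) YRing :=
  ∏ i ∈ Finset.range m, (MvPolynomial.X k - MvPolynomial.C (y (i + 1)))

/-- The product of the factorial powers of the variables with exponents `β`. -/
noncomputable def facMono (β : Fin d → ℕ) : MvPolynomial (Fin d) YRing := ∏ k, facPow k (β k)

/-- The exponents `(d - 1, …, 1, 0)`. -/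
def staircase (d : ℕ) (k : Fin d) : ℕ := d - 1 - k

/-- Add one to the entries of `α` indexed by `U`. -/
def addCol (α : Fin d → ℕ) (U : Finset (Fin d)) : Fin d → ℕ :=
  fun k => α k + if k ∈ U then 1 else 0

/-- The contribution of the barred entries `D \ U` of a column `D` to the weight of a barred
tableau, if `α` is the content of the unbarred word read before. -/
noncomputable def barWeight (α : Fin d → ℕ) (j : ℕ) (D U : Finset (Fin d)) : YRing :=
  ∏ a ∈ D \ U, (y (prime a + α a) - y (j + 1 + gap D a))

theorem facMono_mul_columnWeight (α : Fin d → ℕ) (j : ℕ) (D : Finset (Fin d)) :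
    facMono (α + staircase d) * columnWeight j D =
      ∑ U ∈ D.powerset, barWeight α j D U • facMono (addCol α U + staircase d) := by
  have h1 : columnWeight j D = ∏ a ∈ D,
      ((MvPolynomial.X a - MvPolynomial.C (y (prime a + α a))) +
        MvPolynomial.C (y (prime a + α a) - y (j + 1 + gap D a))) := by
    refine Finset.prod_congr rfl fun a _ => ?_
    rw [entryFactor, map_sub]
    ring
  rw [h1, Finset.prod_add, Finset.mul_sum]
  refine Finset.sum_congr rfl fun U _ => ?_
  rw [barWeight, ← map_prod, ← mul_assoc, mul_comm, ← MvPolynomial.smul_eq_C_mul]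
  congr 1
  have h2 : ∏ a ∈ U, (MvPolynomial.X a - MvPolynomial.C (y (prime a + α a)) :
      MvPolynomial (Fin d) YRing) = ∏ a, if a ∈ U then
        (MvPolynomial.X a - MvPolynomial.C (y (prime a + α a)) :
          MvPolynomial (Fin d) YRing) else 1 := by
    rw [Finset.prod_ite_mem, Finset.univ_inter]
  rw [facMono, facMono, h2, ← Finset.prod_mul_distrib]
  refine Finset.prod_congr rfl fun a _ => ?_
  -- The index a' + α_a is exactly that of the next factor in the factorial power with exponent α_a
  -- + δ_a.
  have hp : prime a + α a = (α a + staircase d a) + 1 := by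
    simp only [prime, staircase]
    omega
  simp only [Pi.add_apply, addCol, facPow]
  split_ifs
  · rw [add_right_comm, Finset.prod_range_succ, hp]
  · rw [mul_one, add_zero]

/-- The antisymmetrization of a polynomial. -/
noncomputable def alternate (d : ℕ) :
    MvPolynomial (Fin d) YRing →ₗ[YRing] MvPolynomial (Fin d) YRing :=
  ∑ σ : Equiv.Perm (Fin d), (Equiv.Perm.sign σ : ℤ) •
    (MvPolynomial.rename (R := YRing) σ).toLinearMap

theorem alternate_apply (f : MvPolynomial (Fin d) YRing) :
    alternate d f = ∑ σ : Equiv.Perm (Fin d), (Equiv.Perm.sign σ : ℤ) •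
      MvPolynomial.rename σ f := by
  simp [alternate, LinearMap.sum_apply]

theorem alternate_mul_of_isSymmetric (f : MvPolynomial (Fin d) YRing)
    {g : MvPolynomial (Fin d) YRing} (hg : g.IsSymmetric) :
    alternate d (f * g) = alternate d f * g := by
  rw [alternate_apply, alternate_apply, Finset.sum_mul]
  refine Finset.sum_congr rfl fun σ _ => ?_
  rw [map_mul, hg σ, smul_mul_assoc]

/-- The terms of σ and σ(k l) cancel. -/
theorem alternate_eq_zero {f : MvPolynomial (Fin d) YRing} {k l : Fin d} (hkl : k ≠ l)
    (hf : swapVar k l f = f) : alternate d f = 0 := by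
  rw [alternate_apply]
  refine Finset.sum_involution (fun σ _ => σ * Equiv.swap k l) ?_ ?_ ?_ ?_
  · intro σ _
    have : MvPolynomial.rename (σ * Equiv.swap k l : Equiv.Perm (Fin d)) f =
        MvPolynomial.rename σ f := by
      conv_rhs => rw [← hf]
      rw [swapVar, MvPolynomial.rename_rename]
      rfl
    rw [this, Equiv.Perm.sign_mul, Equiv.Perm.sign_swap hkl]
    simp
  · intro σ _ _ h
    have := Equiv.swap_eq_one_iff.1 (mul_eq_left.1 h)
    exact hkl this
  · intro σ _
    exact Finset.mem_univ _
  · intro σ _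
    simp [mul_assoc]

/-- The full set contains every `l`, so the sum is invariant under all adjacent transpositions, and
these generate the symmetric group. -/
theorem isSymmetric_columnSum (h : ℕ → ℕ) (n j : ℕ) :
    (columnSum h n j (Finset.univ : Finset (Fin d))).IsSymmetric := by
  cases d with
  | zero => intro σ; rw [Subsingleton.elim σ 1]; simp [MvPolynomial.rename_id]
  | succ d =>
    intro σ
    have hσ : σ ∈ Submonoid.closure
        (Set.range fun i : Fin d => Equiv.swap i.castSucc i.succ) := by
      rw [Equiv.Perm.mclosure_swap_castSucc_succ]
      trivial
    induction hσ using Submonoid.closure_induction with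
    | mem x hx =>
      obtain ⟨i, rfl⟩ := hx
      exact swapVar_columnSum (by simp) n j _ fun _ => Finset.mem_univ _
    | one => simp [MvPolynomial.rename_id]
    | mul a b _ _ ha hb =>
      rw [Equiv.Perm.coe_mul, ← MvPolynomial.rename_rename, hb, ha]

theorem swapVar_facMono {k l : Fin d} {β : Fin d → ℕ} (hβ : β k = β l) :
    swapVar k l (facMono β) = facMono β := by
  rw [facMono, map_prod, ← Equiv.prod_comp (Equiv.swap k l)]
  refine Finset.prod_congr rfl fun a _ => ?_
  have h1 : β (Equiv.swap k l a) = β a := by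
    rw [Equiv.swap_apply_def]
    split_ifs with h1 h2
    · rw [h1, hβ]
    · rw [h2, hβ]
    · rfl
  simp [facPow, h1]

theorem exists_adjacent_lt_of_not_antitone {β : Fin d → ℕ} (hβ : ¬ Antitone β) :
    ∃ k l : Fin d, (l : ℕ) = k + 1 ∧ β k < β l := by
  cases d with
  | zero => exact absurd (fun a => a.elim0) hβ
  | succ d =>
    rw [Fin.antitone_iff_succ_le] at hβ
    push Not at hβ
    obtain ⟨i, hi⟩ := hβ
    exact ⟨i.castSucc, i.succ, by simp, hi⟩

open Classical in
/-- The weight of a column `x.1` with unbarred entries `x.2` following the column `s.1`, if `s.2`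
is the content of the unbarred word read before. -/
noncomputable def barStep (h : ℕ → ℕ) (j : ℕ) (s : Finset (Fin d) × (Fin d → ℕ))
    (x : Finset (Fin d) × Finset (Fin d)) : YRing :=
  if x.1.card = h j ∧ ColLE x.1 s.1 ∧ x.2 ⊆ x.1 ∧ Antitone (addCol s.2 x.2) then
    barWeight s.2 j x.1 x.2 else 0

/-- The state reached after reading the column `x.1` with unbarred entries `x.2`. -/
def barNext (s : Finset (Fin d) × (Fin d → ℕ)) (x : Finset (Fin d) × Finset (Fin d)) :
    Finset (Fin d) × (Fin d → ℕ) := (x.1, addCol s.2 x.2)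

/-- A column raises each part by at most one, so the failure occurs at adjacent places with α_k =
α_l, `l ∈ U` and `k ∉ U`. After adding δ the exponents at `k` and `l` coincide, and `l ∈ D` makes
the columns still to come symmetric in the two variables. -/
theorem alternate_eq_zero_of_not_antitone {α : Fin d → ℕ} (hα : Antitone α)
    {D U : Finset (Fin d)} (hU : U ⊆ D) (hna : ¬ Antitone (addCol α U)) (h : ℕ → ℕ) (n j : ℕ) :
    alternate d (facMono (addCol α U + staircase d) * columnSum h n j D) = 0 := by
  obtain ⟨k, l, hl, hlt⟩ := exists_adjacent_lt_of_not_antitone hna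
  have h1 : α l ≤ α k := hα (by rw [Fin.le_def]; omega)
  simp only [addCol] at hlt
  have hlU : l ∈ U := by
    by_contra hlU
    rw [if_neg hlU] at hlt
    omega
  have hkU : k ∉ U := by
    intro hkU
    rw [if_pos hkU, if_pos hlU] at hlt
    omega
  rw [if_neg hkU, if_pos hlU] at hlt
  apply alternate_eq_zero (k := k) (l := l) (by rintro rfl; omega)
  rw [map_mul, swapVar_columnSum hl n j D fun _ => hU hlU, swapVar_facMono]
  simp only [Pi.add_apply, addCol, staircase, if_neg hkU, if_pos hlU]
  omega

/-- Expansion of the product of an alternant and a generating function of columns. -/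
theorem alternate_facMono_mul_columnSum (h : ℕ → ℕ) (n : ℕ) : ∀ (j : ℕ) (C : Finset (Fin d))
    (α : Fin d → ℕ), Antitone α →
    alternate d (facMono (α + staircase d) * columnSum h n j C) =
      transferSum (barStep h) barNext (fun s => alternate d (facMono (s.2 + staircase d))) n j
        (C, α) := by
  classical
  induction n with
  | zero => intro j C α _; simp [columnSum, transferSum]
  | succ n ih =>
    intro j C α hα
    rw [columnSum, transferSum, Finset.mul_sum, map_sum, Fintype.sum_prod_type, nextColumns,
      Finset.sum_filter]
    refine Finset.sum_congr rfl fun D _ => ?_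
    simp only [barStep, barNext]
    split_ifs with hD
    · rw [← mul_assoc, facMono_mul_columnWeight, Finset.sum_mul, map_sum,
        ← Finset.sum_subset (Finset.subset_univ D.powerset)]
      · refine Finset.sum_congr rfl fun U hU => ?_
        rw [Finset.mem_powerset] at hU
        rw [smul_mul_assoc, map_smul]
        by_cases hna : Antitone (addCol α U)
        · rw [if_pos ⟨hD.1, hD.2, hU, hna⟩, ih _ _ _ hna]
        · rw [if_neg (fun h => hna h.2.2.2), zero_smul,
            alternate_eq_zero_of_not_antitone hα hU hna, smul_zero]
      · intro U _ hU
        rw [Finset.mem_powerset] at hU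
        rw [if_neg (fun h => hU h.2.2.1), zero_smul]
    · symm
      refine Finset.sum_eq_zero fun U _ => ?_
      rw [if_neg (fun h => hD ⟨h.1, h.2.1⟩), zero_smul]

/-! ### The single surviving term for λ = 0 -/

/-- The set of the `m` smallest elements. -/
def initSeg (d m : ℕ) : Finset (Fin d) := Finset.univ.filter fun a => (a : ℕ) < m

theorem mem_initSeg {m : ℕ} {a : Fin d} : a ∈ initSeg d m ↔ (a : ℕ) < m := by simp [initSeg]

theorem card_initSeg {m : ℕ} (hm : m ≤ d) : (initSeg d m).card = m := by
  rw [initSeg, Fin.card_filter_val_lt, min_eq_right hm]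

theorem eq_initSeg_of_isLowerSet {C : Finset (Fin d)} (hC : IsLowerSet (C : Set (Fin d))) :
    C = initSeg d C.card := by
  have hle : C.card ≤ d := by simpa using C.card_le_univ
  apply Finset.eq_of_subset_of_card_le
  · intro a ha
    rw [mem_initSeg]
    have h1 : Finset.Iic a ⊆ C := fun b hb => hC (Finset.mem_Iic.1 hb) ha
    have h2 := Finset.card_le_card h1
    rw [Fin.card_Iic] at h2
    omega
  · rw [card_initSeg hle]

theorem isLowerSet_initSeg (m : ℕ) : IsLowerSet (initSeg d m : Set (Fin d)) := by
  intro a b hab ha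
  rw [Finset.mem_coe, mem_initSeg] at ha ⊢
  rw [Fin.le_def] at hab
  omega

theorem ColLE.of_subset {D C : Finset (Fin d)} (h : D ⊆ C) : ColLE D C :=
  fun _ => Finset.card_le_card (Finset.filter_subset_filter _ h)

theorem ColLE.subset {D C : Finset (Fin d)} (h : ColLE D C) (hC : IsLowerSet (C : Set (Fin d))) :
    D ⊆ C := by
  intro a ha
  have h1 : 0 < countGE D a := Finset.card_pos.2 ⟨a, by simp [ha]⟩
  obtain ⟨b, hb⟩ := Finset.card_pos.1 (h1.trans_le (h a))
  rw [Finset.mem_filter] at hb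
  exact hC hb.2 hb.1

/-- The largest entry of `D` is barred, and no larger entry lies in the column, so both indices in
its factor are equal. -/
theorem barWeight_eq_zero {α : Fin d → ℕ} {j : ℕ} {D U : Finset (Fin d)}
    (hα : ∀ a ∈ D, α a = j) (hUD : U ⊆ D) (hU : IsLowerSet (U : Set (Fin d))) (hne : U ≠ D) :
    barWeight α j D U = 0 := by
  have hD : D.Nonempty := by
    rw [Finset.nonempty_iff_ne_empty]
    rintro rfl
    exact hne (Finset.subset_empty.1 hUD)
  have hm : D.max' hD ∉ U := fun hm =>
    hne (Finset.Subset.antisymm hUD fun a ha => hU (Finset.le_max' D a ha) hm)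
  refine Finset.prod_eq_zero (i := D.max' hD)
    (Finset.mem_sdiff.2 ⟨Finset.max'_mem D hD, hm⟩) ?_
  have h1 := gap_add_countGE D (D.max' hD)
  have h2 : countGE D (D.max' hD + 1) = 0 := by
    rw [countGE, Finset.card_eq_zero, Finset.filter_eq_empty_iff]
    intro a ha hlt
    have := Finset.le_max' D a ha
    rw [Fin.le_def] at this
    omega
  rw [hα _ (Finset.max'_mem D hD), sub_eq_zero]
  congr 1
  simp only [prime]
  omega

/-- Where α is constant, adding `x.2` keeps it weakly decreasing only if `x.2` is an initial
segment. Then `barWeight_eq_zero` forbids barred entries, so the whole column is that segment. -/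
theorem barStep_ne_zero {h : ℕ → ℕ} {j : ℕ} {C : Finset (Fin d)} {α : Fin d → ℕ}
    (hC : IsLowerSet (C : Set (Fin d))) (hα : ∀ a ∈ C, α a = j)
    {x : Finset (Fin d) × Finset (Fin d)} (hx : barStep h j (C, α) x ≠ 0) :
    x = (initSeg d (h j), initSeg d (h j)) := by
  rw [barStep] at hx
  split_ifs at hx with hc
  · obtain ⟨hcard, hle, hUD, hanti⟩ := hc
    have hDC := hle.subset hC
    have hU : IsLowerSet (x.2 : Set (Fin d)) := by
      intro l k hkl hl
      have h1 := hanti hkl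
      have hlC := hDC (hUD hl)
      simp only [addCol, hα l hlC, hα k (hC hkl hlC), if_pos (Finset.mem_coe.1 hl)] at h1
      by_contra hk
      rw [if_neg (by simpa using hk)] at h1
      omega
    have heq : x.2 = x.1 := by
      by_contra hne
      exact hx (barWeight_eq_zero (fun a ha => hα a (hDC ha)) hUD hU hne)
    have h2 := eq_initSeg_of_isLowerSet hU
    rw [heq, hcard] at h2
    exact Prod.ext h2 (heq.trans h2)
  · exact absurd rfl hx

/-- The hypotheses on `C` and `α` reproduce themselves: after the forced step, the new column is an
initial segment on which the content is constantly `j + 1`. -/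
theorem transferSum_barStep_of_const {M : Type*} [AddCommMonoid M] [Module YRing M]
    {h : ℕ → ℕ} (hh : Antitone h) (φ : (Fin d → ℕ) → M) (n : ℕ) :
    ∀ (j : ℕ) (C : Finset (Fin d)) (α : Fin d → ℕ), IsLowerSet (C : Set (Fin d)) →
      (∀ a ∈ C, α a = j) → Antitone α → h j ≤ C.card →
      transferSum (barStep h) barNext (fun s => φ s.2) n j (C, α) =
        φ fun k => α k + ((Finset.range n).filter fun i => (k : ℕ) < h (j + i)).card := by
  induction n with
  | zero => intro j C α _ _ _ _; simp [transferSum]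
  | succ n ih =>
    intro j C α hC hα hanti hcard
    have hle : C.card ≤ d := by simpa using C.card_le_univ
    rw [transferSum, Finset.sum_eq_single (initSeg d (h j), initSeg d (h j))]
    · have hsub : initSeg d (h j) ⊆ C := by
        rw [eq_initSeg_of_isLowerSet hC]
        intro a ha
        rw [mem_initSeg] at ha ⊢
        omega
      have hanti' : Antitone (addCol α (initSeg d (h j))) := by
        intro k l hkl
        have h1 := hanti hkl
        rw [Fin.le_def] at hkl
        simp only [addCol, mem_initSeg]
        split_ifs <;> omega
      rw [barStep, if_pos ⟨card_initSeg (hcard.trans hle), ColLE.of_subset hsub,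
        Finset.Subset.refl _, hanti'⟩, barWeight, Finset.sdiff_self, Finset.prod_empty, one_smul,
        barNext, ih (j + 1) _ _ (isLowerSet_initSeg _) ?_ hanti' ?_]
      · congr 1
        ext k
        rw [Finset.range_eq_Ico, Finset.range_eq_Ico, Finset.card_filter, Finset.card_filter,
          ← Finset.range_eq_Ico, ← Finset.range_eq_Ico, Finset.sum_range_succ']
        simp only [addCol, mem_initSeg, add_zero]
        simp only [add_assoc, add_comm 1]
        rw [add_comm (Finset.sum _ _)]
      · intro a ha
        simp only [addCol, if_pos ha, hα a (hsub ha)]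
      · rw [card_initSeg (hcard.trans hle)]
        exact hh (Nat.le_succ j)
    · intro x _ hx
      by_cases h0 : barStep h j (C, α) x = 0
      · rw [h0, zero_smul]
      · exact absurd (barStep_ne_zero hC hα h0) hx
    · intro h
      exact absurd (Finset.mem_univ _) h

/-- The length of the column of `μ` with (zero-based) index `j`. -/
def colHeight (μ : DPartition d) (j : ℕ) : ℕ := (Finset.univ.filter fun i => j < μ.1 i).card

theorem colHeight_le (μ : DPartition d) (j : ℕ) : colHeight μ j ≤ d := by
  exact (Finset.card_le_univ _).trans (by simp)

theorem antitone_colHeight (μ : DPartition d) : Antitone (colHeight μ) := by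
  intro j j' hj
  refine Finset.card_le_card fun i hi => ?_
  rw [Finset.mem_filter] at hi ⊢
  exact ⟨hi.1, lt_of_le_of_lt hj hi.2⟩

theorem lt_colHeight {μ : DPartition d} {i : Fin d} {j : ℕ} : (i : ℕ) < colHeight μ j ↔ j < μ.1 i := by
  have hlow : IsLowerSet ((Finset.univ.filter fun i => j < μ.1 i : Finset (Fin d)) : Set (Fin d)) := by
    intro a b hab ha
    simp only [Finset.coe_filter, Finset.mem_univ, true_and, Set.mem_ofPred_eq] at ha ⊢
    exact ha.trans_le (μ.2 hab)
  have h1 := eq_initSeg_of_isLowerSet hlow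
  rw [colHeight, ← mem_initSeg, ← h1]
  simp

theorem le_numColumns (μ : DPartition d) (i : Fin d) : μ.1 i ≤ numColumns μ :=
  Finset.le_sup (f := μ.1) (Finset.mem_univ i)

theorem antitone_zero_function : Antitone (0 : Fin d → ℕ) := fun _ _ _ => le_rfl

/-- The bialternant formula, with the generating function of columns in place of the factorial
Schur function. -/
theorem alternate_staircase_mul_columnSum (μ : DPartition d) :
    alternate d (facMono (staircase d)) *
        columnSum (colHeight μ) (numColumns μ) 0 Finset.univ =
      alternate d (facMono (μ.1 + staircase d)) := by
  rw [← alternate_mul_of_isSymmetric _ (isSymmetric_columnSum _ _ _)]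
  have h := alternate_facMono_mul_columnSum (d := d) (colHeight μ) (numColumns μ) 0 Finset.univ 0
    antitone_zero_function
  rw [zero_add] at h
  rw [h, transferSum_barStep_of_const (antitone_colHeight μ)
    (fun α => alternate d (facMono (α + staircase d))) (numColumns μ) 0 Finset.univ 0 (by intro a b _ _; simp)
    (fun _ _ => rfl) antitone_zero_function (by simpa using colHeight_le μ 0)]
  congr 3
  ext k
  have h1 : ((Finset.range (numColumns μ)).filter fun i => (k : ℕ) < colHeight μ (0 + i)) =
      Finset.range (μ.1 k) := by
    ext i
    have := le_numColumns μ k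
    rw [Finset.mem_filter, zero_add, lt_colHeight, Finset.mem_range, Finset.mem_range]
    omega
  rw [h1, Finset.card_range, Pi.zero_apply, zero_add]

/-! ### Linear independence of the alternants by vanishing -/

section LinearIndependence

/-- The shift by one matters, since `y 0` and `y 1` are the same variable. -/
theorem y_injective {m n : ℕ} (h : y (m + 1) = y (n + 1)) : m = n := by
  have h1 := MvPolynomial.X_injective h
  have h2 := congrArg PNat.val h1
  rw [Nat.toPNat'_coe, Nat.toPNat'_coe] at h2
  simpa using h2

/-- Evaluation at `x_k = y_{γ_k + 1}`. -/
noncomputable def evalAt (γ : Fin d → ℕ) : MvPolynomial (Fin d) YRing →ₐ[YRing] YRing :=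
  MvPolynomial.aeval fun k => y (γ k + 1)

theorem evalAt_rename_facMono (γ β : Fin d → ℕ) (σ : Equiv.Perm (Fin d)) :
    evalAt γ (MvPolynomial.rename σ (facMono β)) =
      ∏ k, ∏ i ∈ Finset.range (β k), (y (γ (σ k) + 1) - y (i + 1)) := by
  simp [facMono, facPow, evalAt, map_prod]

theorem evalAt_rename_facMono_ne_zero_iff (γ β : Fin d → ℕ) (σ : Equiv.Perm (Fin d)) :
    evalAt γ (MvPolynomial.rename σ (facMono β)) ≠ 0 ↔ ∀ k, β k ≤ γ (σ k) := by
  rw [evalAt_rename_facMono, Finset.prod_ne_zero_iff]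
  refine forall_congr' fun k => ?_
  rw [Finset.prod_ne_zero_iff]
  simp only [Finset.mem_univ, forall_true_left, Finset.mem_range, sub_ne_zero]
  constructor
  · intro h
    by_contra hlt
    exact h _ (not_le.1 hlt) rfl
  · intro h i hi heq
    have := y_injective heq
    omega

/-- By pigeonhole, σ cannot map the `k + 1` indices up to `k` into the `k` indices below `k`; some i
≤ k with σ i ≥ k gives β_k ≤ β_i ≤ γ_{σ i} ≤ γ_k. -/
theorem le_of_le_perm {γ β : Fin d → ℕ} (hγ : Antitone γ) (hβ : Antitone β)
    {σ : Equiv.Perm (Fin d)} (h : ∀ k, β k ≤ γ (σ k)) : β ≤ γ := by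
  intro k
  obtain ⟨i, hi, hk⟩ : ∃ i, i ≤ k ∧ k ≤ σ i := by
    by_contra hcon
    push Not at hcon
    have h1 : (Finset.Iic k).map σ.toEmbedding ⊆ Finset.Iio k := by
      intro b hb
      obtain ⟨i, hi, rfl⟩ := Finset.mem_map.1 hb
      exact Finset.mem_Iio.2 (hcon i (Finset.mem_Iic.1 hi))
    have h2 := Finset.card_le_card h1
    rw [Finset.card_map, Fin.card_Iic, Fin.card_Iio] at h2
    omega
  exact (hβ hi).trans ((h i).trans (hγ hk))

theorem perm_eq_one_of_le {σ : Equiv.Perm (Fin d)} (h : ∀ k, σ k ≤ k) : σ = 1 := by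
  ext k
  rw [Equiv.Perm.one_apply]
  induction k using WellFoundedLT.induction with
  | _ k ih =>
    by_contra hne
    have hlt : σ k < k := lt_of_le_of_ne (h k) fun h => hne (congrArg Fin.val h)
    have := ih _ hlt
    exact hlt.ne (σ.injective (Fin.ext this))

theorem evalAt_alternate (γ : Fin d → ℕ) (f : MvPolynomial (Fin d) YRing) :
    evalAt γ (alternate d f) = ∑ σ : Equiv.Perm (Fin d), (Equiv.Perm.sign σ : ℤ) •
      evalAt γ (MvPolynomial.rename σ f) := by
  rw [alternate_apply, map_sum]
  exact Finset.sum_congr rfl fun σ _ => map_zsmul _ _ _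

theorem evalAt_alternate_eq_zero {γ β : Fin d → ℕ} (hγ : Antitone γ) (hβ : Antitone β)
    (h : ¬ β ≤ γ) : evalAt γ (alternate d (facMono β)) = 0 := by
  rw [evalAt_alternate]
  refine Finset.sum_eq_zero fun σ _ => ?_
  have : evalAt γ (MvPolynomial.rename σ (facMono β)) = 0 := by
    by_contra hne
    exact h (le_of_le_perm hγ hβ ((evalAt_rename_facMono_ne_zero_iff γ β σ).1 hne))
  rw [this, smul_zero]

theorem evalAt_alternate_self_ne_zero {β : Fin d → ℕ} (hβ : StrictAnti β) :
    evalAt β (alternate d (facMono β)) ≠ 0 := by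
  rw [evalAt_alternate, Finset.sum_eq_single 1]
  · rw [Equiv.Perm.sign_one, Units.val_one, one_smul]
    exact (evalAt_rename_facMono_ne_zero_iff β β 1).2 fun _ => le_rfl
  · intro σ _ hσ
    have : evalAt β (MvPolynomial.rename σ (facMono β)) = 0 := by
      by_contra hne
      refine hσ (perm_eq_one_of_le fun k => ?_)
      exact hβ.le_iff_ge.1 ((evalAt_rename_facMono_ne_zero_iff β β σ).1 hne k)
    rw [this, smul_zero]
  · intro h
    exact absurd (Finset.mem_univ _) h

theorem strictAnti_add_staircase (ν : DPartition d) : StrictAnti (ν.1 + staircase d) := by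
  intro k l hkl
  have h1 := ν.2 hkl.le
  have hl := l.2
  rw [Fin.lt_def] at hkl
  simp only [Pi.add_apply, staircase]
  omega

/-- Evaluation at the point of a minimal ν in the support leaves only the term of ν, whose alternant
is nonzero there. -/
theorem alternant_coeff_eq_zero (c : DPartition d →₀ YRing)
    (hc : (c.sum fun ν a => a • alternate d (facMono (ν.1 + staircase d))) = 0) : c = 0 := by
  by_contra hne
  obtain ⟨ν, hν⟩ := Finset.exists_minimal (Finsupp.support_nonempty_iff.2 hne)
  have h1 := congrArg (evalAt (ν.1 + staircase d)) hc
  rw [Finsupp.sum, map_sum, map_zero, Finset.sum_eq_single ν, map_smul, smul_eq_mul,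
    mul_eq_zero] at h1
  · rcases h1 with h1 | h1
    · exact Finsupp.mem_support_iff.1 hν.1 h1
    · exact evalAt_alternate_self_ne_zero (strictAnti_add_staircase ν) h1
  · intro ν' hν' hne'
    rw [map_smul, evalAt_alternate_eq_zero (strictAnti_add_staircase ν).antitone
      (strictAnti_add_staircase ν').antitone, smul_zero]
    intro hle
    have hle' : ν' ≤ ν := fun k => by simpa using hle k
    exact hne' (le_antisymm hle' (hν.2 hν' hle'))
  · intro h
    exact absurd hν.1 h

theorem alternate_staircase_ne_zero : alternate d (facMono (staircase d)) ≠ 0 := by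
  intro h
  have h1 := evalAt_alternate_self_ne_zero
    (strictAnti_add_staircase (⟨0, antitone_zero_function⟩ : DPartition d))
  rw [zero_add, h, map_zero] at h1
  exact h1 rfl

end LinearIndependence

end FactorialSchur

/-! ### Reverse tableaux as sequences of columns -/

namespace FactorialSchur

variable {d : ℕ} {μ : DPartition d}

theorem Cell.ext_val {b b' : Cell μ} (h1 : b.1 = b'.1) (h2 : (b.2 : ℕ) = b'.2) : b = b' := by
  obtain ⟨i, j⟩ := b
  obtain ⟨i', j'⟩ := b'
  dsimp only at h1
  subst h1
  exact Sigma.ext rfl (heq_of_eq (Fin.ext h2))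

theorem Cell.row_lt_colHeight (b : Cell μ) : (b.1 : ℕ) < colHeight μ b.2 := lt_colHeight.2 b.2.2

theorem Cell.col_lt_numColumns (b : Cell μ) : (b.2 : ℕ) < numColumns μ :=
  b.2.2.trans_le (le_numColumns μ b.1)

/-- The set of the entries in column `j`. -/
def colSet (T : Cell μ → Fin d) (j : ℕ) : Finset (Fin d) :=
  (Finset.univ.filter fun b : Cell μ => (b.2 : ℕ) = j).image T

theorem mem_colSet {T : Cell μ → Fin d} {j : ℕ} {a : Fin d} :
    a ∈ colSet T j ↔ ∃ b : Cell μ, (b.2 : ℕ) = j ∧ T b = a := by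
  simp only [colSet, Finset.mem_image, Finset.mem_filter, Finset.mem_univ, true_and]

/-- Strict decrease of the entries of each column in the row number. -/
def ColStrict (T : Cell μ → Fin d) : Prop :=
  ∀ b b' : Cell μ, (b.2 : ℕ) = b'.2 → b'.1 < b.1 → T b < T b'

theorem IsReverseTableau.colStrict {T : Cell μ → Fin d} (hT : IsReverseTableau T) :
    ColStrict T := fun b b' h1 h2 =>
  hT.2 b b' (by simp [Cell.col, h1]) (by simpa [Cell.row] using h2)

namespace ColStrict

variable {T T' : Cell μ → Fin d} (hT : ColStrict T)

include hT

theorem row_le_iff {b b' : Cell μ} (h : (b.2 : ℕ) = b'.2) : T b ≤ T b' ↔ b'.1 ≤ b.1 := by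
  rcases lt_trichotomy b'.1 b.1 with h1 | h1 | h1
  · exact iff_of_true (hT b b' h h1).le h1.le
  · rw [Cell.ext_val h1.symm h]
    simp
  · exact iff_of_false (hT b' b h.symm h1).not_ge h1.not_ge

theorem cell_eq {b b' : Cell μ} (h : (b.2 : ℕ) = b'.2) (hb : T b = T b') : b = b' :=
  Cell.ext_val (le_antisymm ((hT.row_le_iff h.symm).1 hb.ge) ((hT.row_le_iff h).1 hb.le)) h

theorem countGE_colSet (j t : ℕ) : countGE (colSet T j) t =
    (Finset.univ.filter fun b : Cell μ => (b.2 : ℕ) = j ∧ t ≤ T b).card := by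
  rw [countGE, colSet, Finset.filter_image, Finset.filter_filter, Finset.card_image_of_injOn]
  intro b hb b' hb' h
  rw [Finset.mem_coe, Finset.mem_filter] at hb hb'
  exact hT.cell_eq (hb.2.1.trans hb'.2.1.symm) h

/-- Rows are numbered from the bottom, where the largest entries stand, so the entries at least `T
b` are those in rows up to that of `b`. -/
theorem countGE_entry (b : Cell μ) : countGE (colSet T b.2) (T b) = b.1 + 1 := by
  rw [hT.countGE_colSet, ← Fin.card_Iic]
  refine Finset.card_bij (fun b' _ => b'.1) ?_ ?_ ?_
  · intro b' hb'
    rw [Finset.mem_filter] at hb'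
    exact Finset.mem_Iic.2 ((hT.row_le_iff hb'.2.1.symm).1 hb'.2.2)
  · intro b₁ h₁ b₂ h₂ h
    rw [Finset.mem_filter] at h₁ h₂
    exact Cell.ext_val h (h₁.2.1.trans h₂.2.1.symm)
  · intro i hi
    rw [Finset.mem_Iic] at hi
    refine ⟨⟨i, ⟨b.2, b.2.2.trans_le (μ.2 hi)⟩⟩, ?_, rfl⟩
    rw [Finset.mem_filter]
    exact ⟨Finset.mem_univ _, rfl,
      (hT.row_le_iff (b := b) (b' := ⟨i, ⟨b.2, b.2.2.trans_le (μ.2 hi)⟩⟩) rfl).2 hi⟩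

theorem gap_entry (b : Cell μ) :
    prime (T b) + b.col - b.row = b.2 + 1 + gap (colSet T b.2) (T b) := by
  have h1 := hT.countGE_entry b
  have h2 := countGE_eq_succ (colSet T b.2) (T b)
  rw [if_pos (mem_colSet.2 ⟨b, rfl, rfl⟩)] at h2
  have h3 := gap_add_countGE (colSet T b.2) (T b)
  simp only [prime, Cell.col, Cell.row]
  omega

theorem card_colSet (j : ℕ) : (colSet T j).card = colHeight μ j := by
  have h : (colSet T j).card = countGE (colSet T j) 0 := by simp [countGE]
  rw [h, hT.countGE_colSet, colHeight]
  refine Finset.card_bij (fun b' _ => b'.1) ?_ ?_ ?_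
  · intro b hb
    rw [Finset.mem_filter] at hb ⊢
    exact ⟨Finset.mem_univ _, hb.2.1 ▸ b.2.2⟩
  · intro b₁ h₁ b₂ h₂ h
    rw [Finset.mem_filter] at h₁ h₂
    exact Cell.ext_val h (h₁.2.1.trans h₂.2.1.symm)
  · intro i hi
    rw [Finset.mem_filter] at hi
    exact ⟨⟨i, ⟨j, hi.2⟩⟩, by simp, rfl⟩

/-- If `T b` exceeded `T b'`, the left column would have as many entries at least `T b` as the row
number of the two boxes, and the right column strictly fewer. -/
theorem le_of_colLE {b b' : Cell μ} (h : b.1 = b'.1)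
    (hle : ColLE (colSet T b.2) (colSet T b'.2)) : T b ≤ T b' := by
  by_contra hlt
  rw [not_le] at hlt
  have h1 := hle (T b)
  have h2 := countGE_eq_succ (colSet T b'.2) (T b')
  rw [if_pos (mem_colSet.2 ⟨b', rfl, rfl⟩), hT.countGE_entry b'] at h2
  have h3 : countGE (colSet T b'.2) (T b) ≤ countGE (colSet T b'.2) (T b' + 1) := by
    refine Finset.card_le_card fun a ha => ?_
    rw [Finset.mem_filter] at ha ⊢
    rw [Fin.lt_def] at hlt
    exact ⟨ha.1, by omega⟩
  rw [hT.countGE_entry b, h] at h1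
  omega

theorem eq_of_colSet_eq (hT' : ColStrict T') (h : ∀ b : Cell μ, colSet T b.2 = colSet T' b.2) :
    T = T' := by
  ext b
  have h1 : T b ∈ colSet T' b.2 := h b ▸ mem_colSet.2 ⟨b, rfl, rfl⟩
  obtain ⟨b', hb', hb''⟩ := mem_colSet.1 h1
  have h2 := hT.countGE_entry b
  have h3 := hT'.countGE_entry b'
  rw [hb', hb'', ← h b, h2] at h3
  have : b = b' := Cell.ext_val (Fin.ext (by omega)) hb'.symm
  rw [← hb'', this]

end ColStrict

theorem IsReverseTableau.colLE {T : Cell μ → Fin d} (hT : IsReverseTableau T) (j : ℕ) :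
    ColLE (colSet T (j + 1)) (colSet T j) := by
  intro t
  rw [hT.colStrict.countGE_colSet, hT.colStrict.countGE_colSet]
  have hlt : ∀ b : Cell μ, (b.2 : ℕ) = j + 1 → j < μ.1 b.1 := fun b hb => by
    have := b.2.2
    omega
  refine Finset.card_le_card_of_injOn
    (fun b => if h : (b.2 : ℕ) = j + 1 then ⟨b.1, ⟨j, hlt b h⟩⟩ else b) ?_ ?_
  · intro b hb
    rw [Finset.mem_coe, Finset.mem_filter] at hb ⊢
    dsimp only
    rw [dif_pos hb.2.1]
    refine ⟨Finset.mem_univ _, rfl, hb.2.2.trans ?_⟩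
    exact hT.1 b ⟨b.1, ⟨j, hlt b hb.2.1⟩⟩ rfl (by simp [Cell.col, hb.2.1])
  · intro b hb b' hb' h
    rw [Finset.mem_coe, Finset.mem_filter] at hb hb'
    dsimp only at h
    rw [dif_pos hb.2.1, dif_pos hb'.2.1] at h
    have h1 := congrArg (fun c : Cell μ => c.1) h
    exact Cell.ext_val h1 (hb.2.1.trans hb'.2.1.symm)

theorem ColLE.trans {C D E : Finset (Fin d)} (h : ColLE C D) (h' : ColLE D E) : ColLE C E :=
  fun t => (h t).trans (h' t)

theorem exists_isReverseTableau (D : ℕ → Finset (Fin d)) (hD : ∀ j, (D j).card = colHeight μ j)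
    (hle : ∀ j, ColLE (D (j + 1)) (D j)) :
    ∃ T : Cell μ → Fin d, IsReverseTableau T ∧ ∀ j, colSet T j = D j := by
  have hlt : ∀ (j i : ℕ), i < colHeight μ j → colHeight μ j - 1 - i < colHeight μ j := by
    intro j i h
    omega
  -- Row `i` from the bottom receives the entry with `i` larger ones in its column; as
  -- `orderEmbOfFin` lists elements increasingly, its position is counted from the end.
  set f : (j i : ℕ) → i < colHeight μ j → Fin d := fun j i h =>
    (D j).orderEmbOfFin (hD j) ⟨colHeight μ j - 1 - i, hlt j i h⟩ with hf
  set T : Cell μ → Fin d := fun b => f b.2 b.1 b.row_lt_colHeight with hTdef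
  have hset : ∀ j, colSet T j = D j := by
    intro j
    ext a
    rw [mem_colSet]
    constructor
    · rintro ⟨b, rfl, rfl⟩
      exact Finset.orderEmbOfFin_mem _ _ _
    · intro ha
      have h1 : a ∈ Set.range ((D j).orderEmbOfFin (hD j)) := by
        rw [Finset.range_orderEmbOfFin]
        exact ha
      obtain ⟨m, rfl⟩ := h1
      have hm := m.2
      have hi : colHeight μ j - 1 - m < colHeight μ j := by omega
      have hid : colHeight μ j - 1 - m < d := hi.trans_le (colHeight_le μ j)
      refine ⟨⟨⟨colHeight μ j - 1 - m, hid⟩, ⟨j, lt_colHeight.1 hi⟩⟩, rfl, ?_⟩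
      simp only [hTdef, hf]
      congr 1
      apply Fin.ext
      simp only
      omega
  have hstrict : ColStrict T := by
    rintro ⟨i, j, hj⟩ ⟨i', j', hj'⟩ h1 h2
    dsimp only at h1 h2
    subst h1
    simp only [hTdef, hf]
    rw [OrderEmbedding.lt_iff_lt, Fin.lt_def]
    have h3 := lt_colHeight.2 hj
    rw [Fin.lt_def] at h2
    simp only
    omega
  have hle' : ∀ j' m, ColLE (D (j' + m)) (D j') := by
    intro j' m
    induction m with
    | zero => exact fun _ => le_rfl
    | succ m ih => exact (hle (j' + m)).trans ih
  refine ⟨T, ⟨fun b b' h1 h2 => ?_, fun b b' h1 h2 => ?_⟩, hset⟩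
  · simp only [Cell.col, Cell.row] at h1 h2
    apply hstrict.le_of_colLE (Fin.ext (by omega))
    rw [hset, hset]
    obtain ⟨m, hm⟩ := Nat.exists_eq_add_of_le (show (b'.2 : ℕ) ≤ b.2 by omega)
    rw [hm]
    exact hle' _ _
  · simp only [Cell.col, Cell.row] at h1 h2
    exact hstrict b b' (by omega) (by rw [Fin.lt_def]; omega)

theorem foldl_take_ofFn {S X : Type*} (upd : S → X → S) (s : S) {n : ℕ} (x : ℕ → X) {j : ℕ}
    (hj : j ≤ n) : ((List.ofFn fun i : Fin n => x i).take j).foldl upd s =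
      ((List.range j).map x).foldl upd s := by
  congr 1
  apply List.ext_getElem
  · simp [hj]
  · intro i h1 h2
    simp

/-- The column sets of the path `p`, extended by empty sets. -/
def extendPath {n : ℕ} (p : Fin n → Finset (Fin d)) (j : ℕ) : Finset (Fin d) :=
  if h : j < n then p ⟨j, h⟩ else ∅

theorem extendPath_val {n : ℕ} (p : Fin n → Finset (Fin d)) (i : Fin n) :
    extendPath p i = p i := by
  rw [extendPath, dif_pos i.2]

theorem colHeight_eq_zero {j : ℕ} (hj : numColumns μ ≤ j) : colHeight μ j = 0 := by
  rw [colHeight, Finset.card_eq_zero, Finset.filter_eq_empty_iff]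
  intro i _
  have := le_numColumns μ i
  omega

theorem exists_isReverseTableau_of_path (D : Fin (numColumns μ) → Finset (Fin d))
    (hD : ∀ j, (D j).card = colHeight μ j)
    (hle : ∀ j : ℕ, j + 1 < numColumns μ → ColLE (extendPath D (j + 1)) (extendPath D j)) :
    ∃ T : Cell μ → Fin d, IsReverseTableau T ∧ ∀ j : Fin (numColumns μ), colSet T j = D j := by
  obtain ⟨T, hT, h⟩ := exists_isReverseTableau (μ := μ) (extendPath D)
    (fun j => by
      by_cases hj : j < numColumns μ
      · rw [extendPath, dif_pos hj, hD]
      · rw [extendPath, dif_neg hj, colHeight_eq_zero (not_lt.1 hj), Finset.card_empty])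
    (fun j => by
      by_cases hj : j + 1 < numColumns μ
      · exact hle j hj
      · rw [extendPath, dif_neg hj]
        exact ColLE.of_subset (Finset.empty_subset _))
  exact ⟨T, hT, fun j => by rw [h, extendPath_val]⟩

theorem ColStrict.eq_of_path_eq {T T' : Cell μ → Fin d} (hT : ColStrict T) (hT' : ColStrict T')
    (h : ∀ j : Fin (numColumns μ), colSet T j = colSet T' j) : T = T' :=
  hT.eq_of_colSet_eq hT' fun b => h ⟨b.2, b.col_lt_numColumns⟩

open Classical in
theorem columnSum_eq_transferSum (h : ℕ → ℕ) (n : ℕ) : ∀ (j : ℕ) (C : Finset (Fin d)),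
    columnSum h n j C = transferSum
      (fun j C D => if D.card = h j ∧ ColLE D C then columnWeight j D else 0)
      (fun _ D => D) (fun _ => 1) n j C := by
  induction n with
  | zero => intro j C; rfl
  | succ n ih =>
    intro j C
    rw [columnSum, transferSum, nextColumns, Finset.sum_filter]
    refine Finset.sum_congr (by ext; simp) fun D _ => ?_
    rw [ih]
    split_ifs <;> simp

theorem prod_cells_eq {R : Type*} [CommMonoid R] (s : Finset (Cell μ)) (f : Cell μ → R) :
    ∏ b ∈ s, f b = ∏ j : Fin (numColumns μ), ∏ b ∈ s with (b.2 : ℕ) = j, f b := by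
  rw [← Finset.prod_fiberwise s (fun b : Cell μ => (⟨b.2, b.col_lt_numColumns⟩ : Fin (numColumns μ)))]
  simp only [Fin.ext_iff]

theorem colLE_univ (D : Finset (Fin d)) : ColLE D Finset.univ :=
  ColLE.of_subset (Finset.subset_univ D)

theorem foldl_map_range_succ_of_snd {X : Type*} (s : X) (x : ℕ → X) (j : ℕ) :
    ((List.range (j + 1)).map x).foldl (fun _ D => D) s = x j := by
  simp [List.range_succ]

/-- The factorial Schur function as a generating function of sequences of columns. -/
theorem factorialSchur_eq_columnSum (μ : DPartition d) :
    factorialSchur μ = columnSum (colHeight μ) (numColumns μ) 0 Finset.univ := by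
  classical
  rw [columnSum_eq_transferSum, transferSum_eq_sum, factorialSchur]
  refine Finset.sum_of_injOn (fun (T : Cell μ → Fin d) (j : Fin (numColumns μ)) => colSet T j)
    ?_ ?_ ?_ ?_
  · intro T hT T' hT' h
    rw [Finset.mem_coe, Finset.mem_filter] at hT hT'
    exact hT.2.colStrict.eq_of_path_eq hT'.2.colStrict (congrFun h)
  · intro T _
    simp
  · intro D _ hD
    rw [smul_eq_mul, mul_one]
    -- A path of nonzero weight satisfies the height and dominance conditions at every step, hence
    -- comes from a tableau.
    by_contra hne
    rw [← ne_eq, Finset.prod_ne_zero_iff] at hne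
    have hval : ∀ j : Fin (numColumns μ), (D j).card = colHeight μ j ∧
        ColLE (D j) (((List.ofFn D).take j).foldl (fun _ D => D) Finset.univ) := by
      intro j
      have h1 := hne j (Finset.mem_univ _)
      rw [zero_add] at h1
      exact (ite_ne_right_iff.1 h1).1
    obtain ⟨T, hT, h⟩ := exists_isReverseTableau_of_path D (fun j => (hval j).1) (fun j hj => by
      have h1 := (hval ⟨j + 1, hj⟩).2
      have h2 : D = fun i : Fin (numColumns μ) => extendPath D i := by
        ext1 i
        rw [extendPath_val]
      rw [h2, foldl_take_ofFn _ _ _ hj.le, foldl_map_range_succ_of_snd] at h1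
      exact h1)
    exact hD ⟨T, by simpa using hT, funext h⟩
  · intro T hT
    rw [Finset.mem_filter] at hT
    have hs := hT.2.colStrict
    rw [smul_eq_mul, mul_one, prod_cells_eq]
    refine Finset.prod_congr rfl fun j _ => ?_
    rw [zero_add, if_pos]
    · dsimp only
      rw [columnWeight]
      conv_rhs => rw [colSet]
      rw [Finset.prod_image]
      · refine Finset.prod_congr rfl fun b hb => ?_
        rw [Finset.mem_filter] at hb
        rw [entryFactor, hs.gap_entry, hb.2]
        rfl
      · intro b hb b' hb' h
        rw [Finset.mem_coe, Finset.mem_filter] at hb hb'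
        exact hs.cell_eq (hb.2.trans hb'.2.symm) h
    · refine ⟨hs.card_colSet j, ?_⟩
      rw [foldl_take_ofFn _ _ (colSet T) j.2.le]
      obtain ⟨j, hj⟩ := j
      cases j with
      | zero => exact colLE_univ _
      | succ j =>
        rw [foldl_map_range_succ_of_snd]
        exact hT.2.colLE j

end FactorialSchur

/-! ### Barred tableaux and the product of an alternant with a factorial Schur function -/

namespace FactorialSchur

variable {d : ℕ} {lam μ : DPartition d}

/-- The set of the values of the unbarred entries in column `j`. -/
def unbarSet (B : Cell μ → Fin d × Bool) (j : ℕ) : Finset (Fin d) :=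
  (Finset.univ.filter fun b : Cell μ => (b.2 : ℕ) = j ∧ (B b).2 = false).image fun b => (B b).1

theorem mem_unbarSet {B : Cell μ → Fin d × Bool} {j : ℕ} {a : Fin d} :
    a ∈ unbarSet B j ↔ ∃ b : Cell μ, (b.2 : ℕ) = j ∧ B b = (a, false) := by
  simp only [unbarSet, Finset.mem_image, Finset.mem_filter, Finset.mem_univ, true_and,
    Prod.ext_iff, and_assoc]
  exact exists_congr fun b => and_congr_right fun _ => and_comm

/-- Content after reading `j` columns with sets of unbarred entries `U`, starting from `α`. -/
def cumContent (α : Fin d → ℕ) (U : ℕ → Finset (Fin d)) (j : ℕ) : Fin d → ℕ :=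
  fun k => α k + ((Finset.range j).filter fun i => k ∈ U i).card

theorem cumContent_zero (α : Fin d → ℕ) (U : ℕ → Finset (Fin d)) : cumContent α U 0 = α := by
  ext k; simp [cumContent]

theorem cumContent_succ (α : Fin d → ℕ) (U : ℕ → Finset (Fin d)) (j : ℕ) :
    cumContent α U (j + 1) = addCol (cumContent α U j) (U j) := by
  ext k
  simp only [cumContent, addCol, Finset.card_filter, Finset.sum_range_succ, add_assoc]

theorem foldl_barNext_snd (C : Finset (Fin d)) (α : Fin d → ℕ) (D U : ℕ → Finset (Fin d))
    (j : ℕ) : (((List.range j).map fun i => (D i, U i)).foldl barNext (C, α)).2 =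
      cumContent α U j := by
  induction j with
  | zero => simp [cumContent_zero]
  | succ j ih =>
    rw [List.range_succ, List.map_append, List.foldl_append, cumContent_succ, ← ih]
    rfl

theorem foldl_barNext_fst_succ (C : Finset (Fin d)) (α : Fin d → ℕ) (D U : ℕ → Finset (Fin d))
    (j : ℕ) : (((List.range (j + 1)).map fun i => (D i, U i)).foldl barNext (C, α)).1 = D j := by
  rw [List.range_succ, List.map_append, List.foldl_append]
  rfl

/-- The contribution of the barred entries of `B` to the weight of a barred tableau, where `α` is
the content of the unbarred word read before. -/
noncomputable def tableauWeight (α : Fin d → ℕ) (B : Cell μ → Fin d × Bool) : YRing :=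
  ∏ b : Cell μ with (B b).2 = true,
    (y (prime (B b).1 + cumContent α (unbarSet B) b.2 (B b).1) -
      y (prime (B b).1 + b.col - b.row))

/-- Barred reverse tableaux such that adding the unbarred content of the first columns to `α` always
gives a partition. -/
def IsDominantTableau (α : Fin d → ℕ) (B : Cell μ → Fin d × Bool) : Prop :=
  IsReverseTableau (fun b => (B b).1) ∧
    ∀ j < numColumns μ, Antitone (cumContent α (unbarSet B) (j + 1))

theorem unbarSet_subset (B : Cell μ → Fin d × Bool) (j : ℕ) :
    unbarSet B j ⊆ colSet (fun b => (B b).1) j := by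
  intro a ha
  obtain ⟨b, hb, hb'⟩ := mem_unbarSet.1 ha
  exact mem_colSet.2 ⟨b, hb, congrArg Prod.fst hb'⟩

/-- Entries of a column are distinct, so the set of unbarred values determines which boxes are
barred. -/
theorem mem_unbarSet_entry {B : Cell μ → Fin d × Bool} (hB : ColStrict fun b => (B b).1)
    (b : Cell μ) : (B b).1 ∈ unbarSet B b.2 ↔ (B b).2 = false := by
  rw [mem_unbarSet]
  constructor
  · rintro ⟨b', hb', h⟩
    rw [← hB.cell_eq hb' (show (B b').1 = (B b).1 by rw [h]), h]
  · intro h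
    exact ⟨b, rfl, Prod.ext rfl h⟩

/-- Sequences of columns with unbarred entries correspond to barred reverse tableaux. -/
theorem eq_of_columns_eq {B B' : Cell μ → Fin d × Bool} (hB : ColStrict fun b => (B b).1)
    (hB' : ColStrict fun b => (B' b).1)
    (h : ∀ j : Fin (numColumns μ), colSet (fun b => (B b).1) j = colSet (fun b => (B' b).1) j)
    (h' : ∀ j : Fin (numColumns μ), unbarSet B j = unbarSet B' j) : B = B' := by
  have h1 := hB.eq_of_path_eq hB' h
  ext1 b
  have h2 : (B b).1 = (B' b).1 := congrFun h1 b
  refine Prod.ext h2 ?_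
  have h3 := mem_unbarSet_entry hB b
  rw [h2, h' ⟨b.2, b.col_lt_numColumns⟩, mem_unbarSet_entry hB' b] at h3
  cases hb : (B b).2 <;> cases hb' : (B' b).2 <;> simp_all

theorem exists_bars {T : Cell μ → Fin d}
    (U : Fin (numColumns μ) → Finset (Fin d)) (hU : ∀ j : Fin (numColumns μ), U j ⊆ colSet T j) :
    ∃ B : Cell μ → Fin d × Bool, (∀ b, (B b).1 = T b) ∧
      ∀ j : Fin (numColumns μ), unbarSet B j = U j := by
  refine ⟨fun b => (T b, decide (T b ∉ U ⟨b.2, b.col_lt_numColumns⟩)), fun _ => rfl, fun j => ?_⟩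
  ext a
  rw [mem_unbarSet]
  constructor
  · rintro ⟨b, hb, hb'⟩
    rw [Prod.ext_iff] at hb'
    have h1 : (⟨b.2, b.col_lt_numColumns⟩ : Fin (numColumns μ)) = j := Fin.ext hb
    simp only [decide_eq_false_iff_not, not_not, h1] at hb'
    exact hb'.1 ▸ hb'.2
  · intro ha
    obtain ⟨b, hb, hb'⟩ := mem_colSet.1 (hU j ha)
    have h1 : (⟨b.2, b.col_lt_numColumns⟩ : Fin (numColumns μ)) = j := Fin.ext hb
    refine ⟨b, hb, Prod.ext hb' ?_⟩
    simpa [h1, hb'] using ha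

theorem barWeight_columns {B : Cell μ → Fin d × Bool} (hB : ColStrict fun b => (B b).1)
    (α : Fin d → ℕ) (j : ℕ) :
    barWeight (cumContent α (unbarSet B) j) j (colSet (fun b => (B b).1) j) (unbarSet B j) =
      ∏ b ∈ (Finset.univ.filter fun b : Cell μ => (B b).2 = true) with (b.2 : ℕ) = j,
        (y (prime (B b).1 + cumContent α (unbarSet B) b.2 (B b).1) -
          y (prime (B b).1 + b.col - b.row)) := by
  symm
  rw [barWeight, Finset.filter_filter]
  refine Finset.prod_bij (fun b _ => (B b).1) ?_ ?_ ?_ ?_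
  · intro b hb
    obtain ⟨-, hb1, rfl⟩ := Finset.mem_filter.1 hb
    rw [Finset.mem_sdiff, mem_unbarSet_entry hB, hb1]
    exact ⟨mem_colSet.2 ⟨b, rfl, rfl⟩, by simp⟩
  · intro b hb b' hb' h
    exact hB.cell_eq ((Finset.mem_filter.1 hb).2.2.trans (Finset.mem_filter.1 hb').2.2.symm) h
  · intro a ha
    rw [Finset.mem_sdiff] at ha
    obtain ⟨b, rfl, rfl⟩ := mem_colSet.1 ha.1
    rw [mem_unbarSet_entry hB] at ha
    exact ⟨b, Finset.mem_filter.2 ⟨Finset.mem_univ _, by simpa using ha.2, rfl⟩, rfl⟩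
  · intro b hb
    obtain ⟨-, -, rfl⟩ := Finset.mem_filter.1 hb
    rw [hB.gap_entry b]

open Classical in
/-- The weighted sum over sequences of columns as a sum over barred reverse tableaux. -/
theorem transferSum_barStep_eq_sum {M : Type*} [AddCommMonoid M] [Module YRing M]
    (φ : (Fin d → ℕ) → M) (α : Fin d → ℕ) :
    transferSum (barStep (colHeight μ)) barNext (fun s => φ s.2) (numColumns μ) 0
      (Finset.univ, α) =
    ∑ B : Cell μ → Fin d × Bool with IsDominantTableau α B,
      tableauWeight α B • φ (cumContent α (unbarSet B) (numColumns μ)) := by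
  rw [transferSum_eq_sum]
  symm
  refine Finset.sum_of_injOn (fun (B : Cell μ → Fin d × Bool) (j : Fin (numColumns μ)) =>
    (colSet (fun b => (B b).1) j, unbarSet B j)) ?_ ?_ ?_ ?_
  · intro B hB B' hB' h
    rw [Finset.mem_coe, Finset.mem_filter] at hB hB'
    exact eq_of_columns_eq hB.2.1.colStrict hB'.2.1.colStrict
      (fun j => congrArg Prod.fst (congrFun h j)) (fun j => congrArg Prod.snd (congrFun h j))
  · intro T _
    simp
  · intro p _ hp
    by_contra hne
    have hne' := left_ne_zero_of_smul hne
    rw [Finset.prod_ne_zero_iff] at hne'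
    set D : Fin (numColumns μ) → Finset (Fin d) := fun j => (p j).1 with hD
    set U : Fin (numColumns μ) → Finset (Fin d) := fun j => (p j).2 with hU
    have h2 : p = fun i : Fin (numColumns μ) => (extendPath D i, extendPath U i) := by
      ext1 i
      rw [extendPath_val, extendPath_val]
    have hval : ∀ j : Fin (numColumns μ), (D j).card = colHeight μ j ∧
        ColLE (D j) (((List.ofFn p).take j).foldl barNext (Finset.univ, α)).1 ∧
        U j ⊆ D j ∧
        Antitone (addCol (((List.ofFn p).take j).foldl barNext (Finset.univ, α)).2 (U j)) := by
      intro j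
      have h1 := hne' j (Finset.mem_univ _)
      rw [zero_add] at h1
      exact (ite_ne_right_iff.1 h1).1
    obtain ⟨T, hT, h⟩ := exists_isReverseTableau_of_path D (fun j => (hval j).1) (fun j hj => by
      have h1 := (hval ⟨j + 1, hj⟩).2.1
      rw [h2, foldl_take_ofFn _ _ (fun i => (extendPath D i, extendPath U i)) hj.le,
        foldl_barNext_fst_succ, ← extendPath_val D] at h1
      exact h1)
    obtain ⟨B, hBT, hBU⟩ := exists_bars U fun j => by rw [h]; exact (hval j).2.2.1
    have hBT' : (fun b => (B b).1) = T := funext hBT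
    refine hp ⟨B, ?_, ?_⟩
    · rw [Finset.mem_coe, Finset.mem_filter]
      refine ⟨Finset.mem_univ _, hBT' ▸ hT, fun j hj => ?_⟩
      have h1 := (hval ⟨j, hj⟩).2.2.2
      rw [h2, foldl_take_ofFn _ _ (fun i => (extendPath D i, extendPath U i)) hj.le,
        foldl_barNext_snd] at h1
      have h3 : cumContent α (unbarSet B) j = cumContent α (extendPath U) j := by
        ext k
        simp only [cumContent]
        congr 2
        apply Finset.filter_congr
        intro i hi
        have hi' := (Finset.mem_range.1 hi).trans hj
        rw [hBU ⟨i, hi'⟩, ← extendPath_val U]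
      rw [cumContent_succ, h3, hBU ⟨j, hj⟩]
      exact h1
    · ext1 j
      dsimp only
      rw [hBT', h, hBU]
  · intro B hB
    rw [Finset.mem_filter] at hB
    have hs := hB.2.1.colStrict
    have hfold : ∀ j ≤ numColumns μ, ((List.ofFn fun j : Fin (numColumns μ) =>
        (colSet (fun b => (B b).1) (j : ℕ), unbarSet B (j : ℕ))).take j).foldl barNext
          (Finset.univ, α) = ((List.range j).map fun i =>
            (colSet (fun b => (B b).1) i, unbarSet B i)).foldl barNext (Finset.univ, α) :=
      fun j hj => foldl_take_ofFn _ _ (fun i => (colSet (fun b => (B b).1) i, unbarSet B i)) hj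
    have hend := hfold (numColumns μ) le_rfl
    rw [List.take_of_length_le (by simp)] at hend
    dsimp only
    rw [hend, foldl_barNext_snd, tableauWeight, prod_cells_eq]
    congr 1
    refine Finset.prod_congr rfl fun j _ => ?_
    rw [hfold _ j.2.le, barStep, foldl_barNext_snd, zero_add, if_pos, barWeight_columns hs]
    refine ⟨hs.card_colSet j, ?_, unbarSet_subset B j, ?_⟩
    · obtain ⟨j, hj⟩ := j
      cases j with
      | zero => exact colLE_univ _
      | succ j =>
        rw [foldl_barNext_fst_succ]
        exact hB.2.1.colLE j
    · rw [← cumContent_succ]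
      exact hB.2.2 j j.2

/-- The product of an alternant and a factorial Schur function. -/
theorem alternate_mul_factorialSchur (lam μ : DPartition d) :
    alternate d (facMono (lam.1 + staircase d)) * factorialSchur μ =
      open Classical in
      ∑ B : Cell μ → Fin d × Bool with IsDominantTableau lam.1 B,
        tableauWeight lam.1 B •
          alternate d (facMono (cumContent lam.1 (unbarSet B) (numColumns μ) + staircase d)) := by
  rw [factorialSchur_eq_columnSum, ← alternate_mul_of_isSymmetric _ (isSymmetric_columnSum _ _ _),
    alternate_facMono_mul_columnSum _ _ _ _ _ lam.2]
  exact transferSum_barStep_eq_sum (fun α => alternate d (facMono (α + staircase d))) lam.1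

/-- The bialternant formula for factorial Schur functions. -/
theorem alternate_staircase_mul_factorialSchur (μ : DPartition d) :
    alternate d (facMono (staircase d)) * factorialSchur μ =
      alternate d (facMono (μ.1 + staircase d)) := by
  rw [factorialSchur_eq_columnSum, alternate_staircase_mul_columnSum]

/-! ### Yamanouchi words relative to a starting content -/

/-- A word is Yamanouchi relative to `α` if `α` plus the content of each of its initial segments is
weakly decreasing. -/
def YamanouchiFrom (α : Fin d → ℕ) (w : List (Fin d)) : Prop :=
  ∀ v : List (Fin d), v <+: w → ∀ k l : Fin d, (l : ℕ) = k + 1 →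
    (α + content v) l ≤ (α + content v) k

theorem isYamanouchi_iff (w : List (Fin d)) : IsYamanouchi w ↔ YamanouchiFrom 0 w := by
  simp [IsYamanouchi, YamanouchiFrom]

theorem content_append (u w : List (Fin d)) : content (u ++ w) = content u + content w := by
  ext k; simp [content]

theorem content_nil : content ([] : List (Fin d)) = 0 := by
  ext k; simp [content]

theorem content_of_nodup {w : List (Fin d)} (hw : w.Nodup) (k : Fin d) :
    content w k = if k ∈ w then 1 else 0 := hw.count

theorem antitone_iff_adjacent {β : Fin d → ℕ} :
    Antitone β ↔ ∀ k l : Fin d, (l : ℕ) = k + 1 → β l ≤ β k := by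
  constructor
  · intro h k l hl
    exact h (by rw [Fin.le_def]; omega)
  · intro h
    by_contra hna
    obtain ⟨k, l, hl, hlt⟩ := exists_adjacent_lt_of_not_antitone hna
    exact absurd (h k l hl) (not_le.2 hlt)

theorem YamanouchiFrom.antitone {α : Fin d → ℕ} {w : List (Fin d)} (h : YamanouchiFrom α w) :
    Antitone (α + content w) :=
  antitone_iff_adjacent.2 (h w List.prefix_rfl)

theorem yamanouchiFrom_append {α : Fin d → ℕ} {u w : List (Fin d)} :
    YamanouchiFrom α (u ++ w) ↔ YamanouchiFrom α u ∧ YamanouchiFrom (α + content u) w := by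
  constructor
  · intro h
    refine ⟨fun v hv => h v (hv.trans (List.prefix_append u w)), fun v hv => ?_⟩
    rw [add_assoc, ← content_append]
    exact h _ ((List.prefix_append_right_inj u).2 hv)
  · rintro ⟨h1, h2⟩ v hv
    rcases List.prefix_or_prefix_of_prefix hv (List.prefix_append u w) with h | h
    · exact h1 v h
    · obtain ⟨t, rfl⟩ := h
      rw [content_append, ← add_assoc]
      exact h2 t ((List.prefix_append_right_inj u).1 hv)

theorem yamanouchiFrom_nil {α : Fin d → ℕ} (hα : Antitone α) : YamanouchiFrom α [] := by
  intro v hv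
  rw [List.prefix_nil.1 hv, content_nil, add_zero]
  exact antitone_iff_adjacent.1 hα

/-- For strictly increasing words, only the whole word matters. -/
theorem yamanouchiFrom_of_pairwise {α : Fin d → ℕ} (hα : Antitone α) {w : List (Fin d)}
    (hw : w.Pairwise (· < ·)) (h : Antitone (α + content w)) : YamanouchiFrom α w := by
  rintro v ⟨t, rfl⟩ k l hl
  have hnd : (v ++ t).Nodup := hw.imp fun h => h.ne
  have h1 := antitone_iff_adjacent.1 h k l hl
  have h2 := antitone_iff_adjacent.1 hα k l hl
  have hv : v.Nodup := hnd.of_append_left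
  simp only [Pi.add_apply, content_of_nodup hnd, content_of_nodup hv, List.mem_append] at h1 ⊢
  by_cases hlv : l ∈ v
  · have hkt : k ∉ t := fun hkt => by
      have := (List.pairwise_append.1 hw).2.2 l hlv k hkt
      rw [Fin.lt_def] at this
      omega
    simpa [hlv, hkt] using h1
  · rw [if_neg hlv]
    omega

theorem mem_columnCells {j : ℕ} {b : Cell μ} : b ∈ columnCells μ j ↔ (b.2 : ℕ) = j := by
  rw [columnCells, List.mem_filterMap]
  constructor
  · rintro ⟨i, -, h⟩
    split_ifs at h with hj
    rw [← Option.some.inj h]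
  · rintro rfl
    exact ⟨b.1, List.mem_finRange _, by rw [dif_pos b.2.2]⟩

theorem pairwise_columnCells (μ : DPartition d) (j : ℕ) :
    (columnCells μ j).Pairwise fun b b' => b.1 < b'.1 := by
  rw [columnCells, List.pairwise_filterMap]
  refine (List.pairwise_lt_finRange d).imp ?_
  intro i i' hii b hb b' hb'
  split_ifs at hb with h1
  split_ifs at hb' with h2
  rw [← Option.some.inj hb, ← Option.some.inj hb']
  exact hii

theorem unbarredEntries_append (L : Filling lam μ) (u w : List (Box lam μ)) :
    unbarredEntries L (u ++ w) = unbarredEntries L u ++ unbarredEntries L w := by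
  simp [unbarredEntries]

theorem mem_unbarredEntries {L : Filling lam μ} {bs : List (Box lam μ)} {a : Fin d} :
    a ∈ unbarredEntries L bs ↔ ∃ b ∈ bs, L b = (a, false) := by
  simp only [unbarredEntries, List.mem_map, List.mem_filter, decide_eq_true_eq, Prod.ext_iff,
    and_assoc]
  exact exists_congr fun b => and_congr_right fun _ => and_comm

/-! ### The reading word of the reverse diagram μ -/

section Right

/-- The boxes of column `j` of `μ` in reading order. -/
def rightColumn (lam μ : DPartition d) (j : ℕ) : List (Box lam μ) :=
  (columnCells μ j).reverse.map Sum.inr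

theorem mem_rightColumn {j : ℕ} {x : Box lam μ} :
    x ∈ rightColumn lam μ j ↔ ∃ b : Cell μ, (b.2 : ℕ) = j ∧ Sum.inr b = x := by
  simp only [rightColumn, List.mem_map, List.mem_reverse, mem_columnCells]

theorem pairwise_unbarredEntries_rightColumn {L : Filling lam μ}
    (hL : ColStrict fun b : Cell μ => (L (Sum.inr b)).1) (j : ℕ) :
    (unbarredEntries L (rightColumn lam μ j)).Pairwise (· < ·) := by
  rw [unbarredEntries, List.pairwise_map]
  refine List.Pairwise.filter _ ?_
  rw [rightColumn, List.pairwise_map, List.pairwise_reverse]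
  refine List.Pairwise.imp_of_mem ?_ (pairwise_columnCells μ j)
  intro b b' hb hb' h
  exact hL b' b ((mem_columnCells.1 hb').trans (mem_columnCells.1 hb).symm) h

theorem content_rightColumn {L : Filling lam μ}
    (hL : ColStrict fun b : Cell μ => (L (Sum.inr b)).1) (j : ℕ) (α : Fin d → ℕ) :
    α + content (unbarredEntries L (rightColumn lam μ j)) =
      addCol α (unbarSet (fun b => L (Sum.inr b)) j) := by
  ext k
  rw [Pi.add_apply, content_of_nodup
    ((pairwise_unbarredEntries_rightColumn hL j).imp fun h => h.ne), addCol]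
  congr 2
  rw [mem_unbarredEntries, mem_unbarSet, eq_iff_iff]
  constructor
  · rintro ⟨x, hx, hxk⟩
    obtain ⟨b, hb, rfl⟩ := mem_rightColumn.1 hx
    exact ⟨b, hb, hxk⟩
  · rintro ⟨b, hb, hbk⟩
    exact ⟨Sum.inr b, mem_rightColumn.2 ⟨b, hb, rfl⟩, hbk⟩

theorem content_rightColumns {L : Filling lam μ}
    (hL : ColStrict fun b : Cell μ => (L (Sum.inr b)).1) (α : Fin d → ℕ) (n : ℕ) :
    α + content (unbarredEntries L ((List.range n).flatMap (rightColumn lam μ))) =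
      cumContent α (unbarSet fun b => L (Sum.inr b)) n := by
  induction n with
  | zero => simp [unbarredEntries, content_nil, cumContent_zero]
  | succ n ih =>
    rw [List.range_succ, List.flatMap_append, unbarredEntries_append, content_append, ← add_assoc,
      ih, List.flatMap_singleton, content_rightColumn hL, cumContent_succ]

/-- Each column contributes a strictly increasing word, so the condition need only be tested at the
ends of columns. -/
theorem yamanouchiFrom_rightColumns {L : Filling lam μ}
    (hL : ColStrict fun b : Cell μ => (L (Sum.inr b)).1) {α : Fin d → ℕ} (hα : Antitone α)
    (n : ℕ) :
    YamanouchiFrom α (unbarredEntries L ((List.range n).flatMap (rightColumn lam μ))) ↔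
      ∀ j < n, Antitone (cumContent α (unbarSet fun b => L (Sum.inr b)) (j + 1)) := by
  induction n with
  | zero => simpa [unbarredEntries] using yamanouchiFrom_nil hα
  | succ n ih =>
    rw [List.range_succ, List.flatMap_append, unbarredEntries_append, yamanouchiFrom_append, ih,
      content_rightColumns hL, List.flatMap_singleton]
    constructor
    · rintro ⟨h1, h2⟩ j hj
      rcases Nat.lt_succ_iff_lt_or_eq.1 hj with hj | rfl
      · exact h1 j hj
      · rw [cumContent_succ, ← content_rightColumn hL]
        exact h2.antitone
    · intro h
      refine ⟨fun j hj => h j (by omega), ?_⟩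
      apply yamanouchiFrom_of_pairwise _ (pairwise_unbarredEntries_rightColumn hL n)
      · rw [content_rightColumn hL, ← cumContent_succ]
        exact h n (by omega)
      · cases n with
        | zero => rwa [cumContent_zero]
        | succ n => exact h n (by omega)

end Right

/-! ### The forced filling of λ -/

section Left

/-- The boxes of column `j` of `lam` in reading order. -/
def leftColumn (lam μ : DPartition d) (j : ℕ) : List (Box lam μ) :=
  (columnCells lam j).map Sum.inl

variable {L : Filling lam μ}

theorem pairwise_unbarredEntries_leftColumn
    (hY : IsYoungTableau fun b : Cell lam => (L (Sum.inl b)).1) (j : ℕ) :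
    (unbarredEntries L (leftColumn lam μ j)).Pairwise (· < ·) := by
  rw [unbarredEntries, List.pairwise_map]
  refine List.Pairwise.filter _ ?_
  rw [leftColumn, List.pairwise_map]
  refine List.Pairwise.imp_of_mem ?_ (pairwise_columnCells lam j)
  intro b b' hb hb' h
  rw [mem_columnCells] at hb hb'
  exact hY.2 b b' (by simp [Cell.col, hb, hb']) (by simpa [Cell.row] using h)

theorem mem_leftColumn (hu : ∀ b : Cell lam, (L (Sum.inl b)).2 = false) {j : ℕ} {a : Fin d} :
    a ∈ unbarredEntries L (leftColumn lam μ j) ↔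
      ∃ b : Cell lam, (b.2 : ℕ) = j ∧ (L (Sum.inl b)).1 = a := by
  rw [mem_unbarredEntries]
  constructor
  · rintro ⟨x, hx, hxk⟩
    obtain ⟨b, hb, rfl⟩ := List.mem_map.1 hx
    exact ⟨b, mem_columnCells.1 hb, congrArg Prod.fst hxk⟩
  · rintro ⟨b, hb, hbk⟩
    exact ⟨Sum.inl b, List.mem_map.2 ⟨b, mem_columnCells.2 hb, rfl⟩, Prod.ext hbk (hu b)⟩

theorem isYoungTableau_row (h : ∀ b : Cell lam, L (Sum.inl b) = (b.1, false)) :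
    IsYoungTableau fun b : Cell lam => (L (Sum.inl b)).1 := by
  simp only [h]
  constructor
  · intro b b' h1 _
    simp only [Cell.row] at h1
    rw [Fin.le_def]
    dsimp only
    omega
  · intro b b' _ h1
    simpa [Cell.row] using h1

theorem content_leftColumn (hu : ∀ b : Cell lam, (L (Sum.inl b)).2 = false)
    (hY : IsYoungTableau fun b : Cell lam => (L (Sum.inl b)).1) {n : ℕ}
    (h : ∀ b : Cell lam, (b.2 : ℕ) = n → (L (Sum.inl b)).1 = b.1) :
    (fun i => lam.1 i - (n + 1)) + content (unbarredEntries L (leftColumn lam μ n)) =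
      fun i => lam.1 i - n := by
  ext i
  rw [Pi.add_apply, content_of_nodup
    ((pairwise_unbarredEntries_leftColumn hY n).imp fun h => h.ne)]
  have h1 : (∃ b : Cell lam, (b.2 : ℕ) = n ∧ (L (Sum.inl b)).1 = i) ↔ n < lam.1 i := by
    constructor
    · rintro ⟨b, hb, hb'⟩
      rw [h b hb] at hb'
      rw [← hb', ← hb]
      exact b.2.2
    · intro hn
      exact ⟨⟨i, ⟨n, hn⟩⟩, rfl, h _ rfl⟩
  rw [if_congr ((mem_leftColumn hu).trans h1) rfl rfl]
  split_ifs <;> omega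

theorem antitone_sub_const (lam : DPartition d) (n : ℕ) : Antitone fun i => lam.1 i - n :=
  fun _ _ h => Nat.sub_le_sub_right (lam.2 h) n

/-- The columns to the right are already row-constant, so the content read before column `n` is the
truncated difference λ_i - (n + 1). Going down the column, strictness gives entry ≥ row; the right
neighbour, or at the end of a row the partition condition, gives the converse. -/
theorem row_eq_of_antitone (hu : ∀ b : Cell lam, (L (Sum.inl b)).2 = false)
    (hY : IsYoungTableau fun b : Cell lam => (L (Sum.inl b)).1) {n : ℕ}
    (h : ∀ b : Cell lam, n + 1 ≤ (b.2 : ℕ) → (L (Sum.inl b)).1 = b.1)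
    (hanti : Antitone
      ((fun i => lam.1 i - (n + 1)) + content (unbarredEntries L (leftColumn lam μ n)))) :
    ∀ b : Cell lam, (b.2 : ℕ) = n → (L (Sum.inl b)).1 = b.1 := by
  have key : ∀ (m : ℕ) (b : Cell lam), (b.1 : ℕ) = m → (b.2 : ℕ) = n →
      (L (Sum.inl b)).1 = b.1 := by
    intro m
    induction m using Nat.strong_induction_on with
    | _ m ih =>
      intro b hbm hbn
      have hge : b.1 ≤ (L (Sum.inl b)).1 := by
        rcases Nat.eq_zero_or_pos m with hm | hm
        · rw [Fin.le_def]
          omega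
        · have hb1 := b.1.2
          have hi : m - 1 < d := by omega
          have hcell : n < lam.1 ⟨m - 1, hi⟩ := by
            have h1 : lam.1 b.1 ≤ lam.1 ⟨m - 1, hi⟩ := lam.2 (by rw [Fin.le_def]; simp only; omega)
            have h2 := b.2.2
            omega
          have h1 := ih (m - 1) (by omega) ⟨⟨m - 1, hi⟩, ⟨n, hcell⟩⟩ rfl rfl
          have h2 := hY.2 ⟨⟨m - 1, hi⟩, ⟨n, hcell⟩⟩ b (by simp [Cell.col, hbn])
            (by simp only [Cell.row]; omega)
          dsimp only at h2
          rw [h1, Fin.lt_def] at h2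
          rw [Fin.le_def]
          simp only at h2
          omega
      by_contra hne
      have hlt : b.1 < (L (Sum.inl b)).1 := lt_of_le_of_ne hge (Ne.symm hne)
      by_cases hrow : n + 1 < lam.1 b.1
      · have h1 := h ⟨b.1, ⟨n + 1, hrow⟩⟩ le_rfl
        have h2 := hY.1 b ⟨b.1, ⟨n + 1, hrow⟩⟩ rfl (by simp [Cell.col, hbn])
        dsimp only at h2
        rw [h1] at h2
        exact absurd h2 hlt.not_ge
      -- The row of `b` ends here, so neither `k` nor `k - 1` has been read in earlier columns.
      -- Hence `k - 1` must occur in this column too, but the boxes above hold their smaller row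
      -- numbers and those below hold entries greater than `k`.
      · set k := (L (Sum.inl b)).1 with hk
        rw [Fin.lt_def] at hlt
        have hkd := k.2
        have hk1 : (k : ℕ) - 1 < d := by omega
        have hle1 : lam.1 k ≤ lam.1 b.1 := lam.2 hge
        have hle2 : lam.1 ⟨k - 1, hk1⟩ ≤ lam.1 b.1 := lam.2 (by rw [Fin.le_def]; simp only; omega)
        have h1 := antitone_iff_adjacent.1 hanti ⟨k - 1, hk1⟩ k (by simp only; omega)
        have hnd := (pairwise_unbarredEntries_leftColumn hY n).imp fun h => h.ne
        rw [Pi.add_apply, Pi.add_apply, content_of_nodup hnd, content_of_nodup hnd,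
          if_pos ((mem_leftColumn hu).2 ⟨b, hbn, rfl⟩)] at h1
        have hmem : (⟨k - 1, hk1⟩ : Fin d) ∈ unbarredEntries L (leftColumn lam μ n) := by
          by_contra hmem
          rw [if_neg hmem] at h1
          omega
        obtain ⟨b', hb'n, hb'⟩ := (mem_leftColumn hu).1 hmem
        rcases lt_trichotomy b'.1 b.1 with h2 | h2 | h2
        · rw [Fin.lt_def] at h2
          have h3 := ih b'.1 (by omega) b' rfl hb'n
          rw [hb'] at h3
          have := congrArg Fin.val h3
          simp only at this
          omega
        · rw [Cell.ext_val h2 (hb'n.trans hbn.symm), ← hk] at hb'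
          have := congrArg Fin.val hb'
          simp only at this
          omega
        · have h3 := hY.2 b b' (by simp [Cell.col, hbn, hb'n]) (by simpa [Cell.row] using h2)
          dsimp only at h3
          rw [hb', ← hk, Fin.lt_def] at h3
          simp only at h3
          omega
  exact fun b hb => key _ b rfl hb

theorem range_succ_reverse_flatMap {X : Type*} (f : ℕ → List X) (n : ℕ) :
    (List.range (n + 1)).reverse.flatMap f = f n ++ (List.range n).reverse.flatMap f := by
  simp [List.range_succ]

theorem row_eq_of_yamanouchiFrom (hu : ∀ b : Cell lam, (L (Sum.inl b)).2 = false)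
    (hY : IsYoungTableau fun b : Cell lam => (L (Sum.inl b)).1) (n : ℕ)
    (h : ∀ b : Cell lam, n ≤ (b.2 : ℕ) → (L (Sum.inl b)).1 = b.1)
    (hyam : YamanouchiFrom (fun i => lam.1 i - n)
      (unbarredEntries L ((List.range n).reverse.flatMap (leftColumn lam μ)))) :
    ∀ b : Cell lam, (L (Sum.inl b)).1 = b.1 := by
  induction n with
  | zero => exact fun b => h b (Nat.zero_le _)
  | succ n ih =>
    rw [range_succ_reverse_flatMap, unbarredEntries_append, yamanouchiFrom_append] at hyam
    have h1 := row_eq_of_antitone hu hY h hyam.1.antitone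
    refine ih (fun b hb => ?_) ?_
    · rcases hb.eq_or_lt with hb | hb
      · exact h1 b hb.symm
      · exact h b hb
    · rw [← content_leftColumn hu hY h1]
      exact hyam.2

theorem yamanouchiFrom_and_content_of_row (h : ∀ b : Cell lam, L (Sum.inl b) = (b.1, false))
    (n : ℕ) :
    YamanouchiFrom (fun i => lam.1 i - n)
      (unbarredEntries L ((List.range n).reverse.flatMap (leftColumn lam μ))) ∧
    (fun i => lam.1 i - n) +
      content (unbarredEntries L ((List.range n).reverse.flatMap (leftColumn lam μ))) = lam.1 := by
  have hu : ∀ b : Cell lam, (L (Sum.inl b)).2 = false := fun b => by rw [h]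
  have hY := isYoungTableau_row h
  induction n with
  | zero =>
    refine ⟨?_, ?_⟩
    · simpa [unbarredEntries] using yamanouchiFrom_nil lam.2
    · ext i; simp [unbarredEntries, content_nil]
  | succ n ih =>
    have h1 := content_leftColumn hu hY (n := n) fun b _ => by rw [h]
    rw [range_succ_reverse_flatMap, unbarredEntries_append, yamanouchiFrom_append, content_append,
      ← add_assoc, h1]
    refine ⟨⟨yamanouchiFrom_of_pairwise (antitone_sub_const lam _)
      (pairwise_unbarredEntries_leftColumn hY n) ?_, ih.1⟩, ih.2⟩
    rw [h1]
    exact antitone_sub_const lam n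

/-- The only Yamanouchi filling of a Young diagram has all entries equal to their row numbers. -/
theorem yamanouchi_left_iff (hu : ∀ b : Cell lam, (L (Sum.inl b)).2 = false)
    (hY : IsYoungTableau fun b : Cell lam => (L (Sum.inl b)).1) :
    YamanouchiFrom 0 (unbarredEntries L
      ((List.range (numColumns lam)).reverse.flatMap (leftColumn lam μ))) ↔
    ∀ b : Cell lam, L (Sum.inl b) = (b.1, false) := by
  have h0 : (0 : Fin d → ℕ) = fun i => lam.1 i - numColumns lam := by
    ext i
    exact (Nat.sub_eq_zero_of_le (le_numColumns lam i)).symm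
  rw [h0]
  constructor
  · intro h b
    refine Prod.ext (row_eq_of_yamanouchiFrom hu hY _ (fun b hb => ?_) h b) (hu b)
    exact absurd b.col_lt_numColumns (not_lt.2 hb)
  · intro h
    exact (yamanouchiFrom_and_content_of_row h _).1

theorem content_left (h : ∀ b : Cell lam, L (Sum.inl b) = (b.1, false)) :
    content (unbarredEntries L
      ((List.range (numColumns lam)).reverse.flatMap (leftColumn lam μ))) = lam.1 := by
  have h1 := (yamanouchiFrom_and_content_of_row h (numColumns lam)).2
  have h0 : (fun i => lam.1 i - numColumns lam) = (0 : Fin d → ℕ) := by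
    ext i
    exact Nat.sub_eq_zero_of_le (le_numColumns lam i)
  rwa [h0, zero_add] at h1

end Left

/-! ### Equivariant Littlewood–Richardson tableaux as barred tableaux of shape μ -/

theorem readingOrder_eq (lam μ : DPartition d) : readingOrder lam μ =
    (List.range (numColumns lam)).reverse.flatMap (leftColumn lam μ) ++
      (List.range (numColumns μ)).flatMap (rightColumn lam μ) := rfl

theorem isEquivariantLR_iff (ν : DPartition d) (L : Filling lam μ) :
    IsEquivariantLR ν L ↔ (∀ b : Cell lam, L (Sum.inl b) = (b.1, false)) ∧
      IsDominantTableau lam.1 (fun b => L (Sum.inr b)) ∧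
      cumContent lam.1 (unbarSet fun b => L (Sum.inr b)) (numColumns μ) = ν.1 := by
  rw [IsEquivariantLR, IsSkewBarredTableau, unbarredWord, readingOrder_eq, unbarredEntries_append,
    isYamanouchi_iff, yamanouchiFrom_append, content_append, zero_add]
  constructor
  · rintro ⟨⟨hu, hY, hR⟩, ⟨h1, h2⟩, h3⟩
    have h := (yamanouchi_left_iff hu hY).1 h1
    rw [content_left h] at h2 h3
    exact ⟨h, ⟨hR, (yamanouchiFrom_rightColumns hR.colStrict lam.2 _).1 h2⟩,
      (content_rightColumns hR.colStrict _ _).symm.trans h3⟩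
  · rintro ⟨h, ⟨hR, h2⟩, h3⟩
    have hu : ∀ b : Cell lam, (L (Sum.inl b)).2 = false := fun b => by rw [h]
    have hY := isYoungTableau_row h
    rw [content_left h]
    exact ⟨⟨hu, hY, hR⟩, ⟨(yamanouchi_left_iff hu hY).2 h,
      (yamanouchiFrom_rightColumns hR.colStrict lam.2 _).2 h2⟩,
      (content_rightColumns hR.colStrict _ _).trans h3⟩

theorem exists_takeWhile_readingOrder (b : Cell μ) : ∃ s : List (Cell μ),
    (∀ c ∈ s, (c.2 : ℕ) = b.2 ∧ b.1 < c.1) ∧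
    ((readingOrder lam μ).takeWhile fun c => c ≠ Sum.inr b) =
      (List.range (numColumns lam)).reverse.flatMap (leftColumn lam μ) ++
      ((List.range b.2).flatMap (rightColumn lam μ) ++ s.map Sum.inr) := by
  have hmem : b ∈ (columnCells μ b.2).reverse := List.mem_reverse.2 (mem_columnCells.2 rfl)
  obtain ⟨s, t, hst⟩ := List.append_of_mem hmem
  have hpw : (columnCells μ b.2).reverse.Pairwise fun c c' => c'.1 < c.1 :=
    List.pairwise_reverse.2 (pairwise_columnCells μ b.2)
  rw [hst] at hpw
  have hs : ∀ c ∈ s, (c.2 : ℕ) = b.2 ∧ b.1 < c.1 := fun c hc => by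
    refine ⟨mem_columnCells.1 (List.mem_reverse.1 ?_),
      (List.pairwise_append.1 hpw).2.2 c hc b List.mem_cons_self⟩
    rw [hst]
    exact List.mem_append_left _ hc
  obtain ⟨m, hm⟩ := Nat.exists_eq_add_of_le (Nat.succ_le_of_lt b.col_lt_numColumns)
  refine ⟨s, hs, ?_⟩
  have hcol : rightColumn lam μ b.2 = s.map Sum.inr ++ Sum.inr b :: t.map Sum.inr := by
    rw [rightColumn, hst, List.map_append, List.map_cons]
  rw [readingOrder_eq, hm, List.range_add, List.flatMap_append, Nat.succ_eq_add_one,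
    List.range_succ, List.flatMap_append, List.flatMap_singleton, hcol,
    List.takeWhile_append_of_pos]
  · congr 1
    rw [List.append_assoc, List.takeWhile_append_of_pos, List.append_assoc,
      List.takeWhile_append_of_pos, List.cons_append, List.takeWhile_cons_of_neg, List.append_nil]
    · simp
    · intro c hc
      obtain ⟨c, hcs, rfl⟩ := List.mem_map.1 hc
      have := (hs c hcs).2.ne'
      simp only [decide_eq_true_eq]
      rintro h
      rw [Sum.inr.inj h] at this
      exact this rfl
    · intro c hc
      obtain ⟨j, hj, hc⟩ := List.mem_flatMap.1 hc
      obtain ⟨c, hc, rfl⟩ := mem_rightColumn.1 hc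
      rw [List.mem_range] at hj
      simp only [decide_eq_true_eq]
      intro h
      have h' := congrArg (fun c : Cell μ => (c.2 : ℕ)) (Sum.inr.inj h)
      omega
  · intro c hc
    obtain ⟨j, hj, hc⟩ := List.mem_flatMap.1 hc
    obtain ⟨c, hc, rfl⟩ := List.mem_map.1 hc
    simp

/-- Besides λ and the earlier columns of μ, the word before `b` contains only unbarred entries above
`b` in its own column. They are strictly smaller, so they do not affect the multiplicity of the
value of `b`. -/
theorem weight_eq {L : Filling lam μ} (h : ∀ b : Cell lam, L (Sum.inl b) = (b.1, false))
    (hR : ColStrict fun b : Cell μ => (L (Sum.inr b)).1) :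
    weight L = tableauWeight lam.1 fun b => L (Sum.inr b) := by
  refine Finset.prod_congr rfl fun b _ => ?_
  obtain ⟨s, hs, hbefore⟩ := exists_takeWhile_readingOrder (lam := lam) b
  have h0 : content (unbarredEntries L (s.map Sum.inr)) (L (Sum.inr b)).1 = 0 := by
    refine List.count_eq_zero.2 fun hmem => ?_
    obtain ⟨c, hc, hLc⟩ := mem_unbarredEntries.1 hmem
    obtain ⟨c, hcs, rfl⟩ := List.mem_map.1 hc
    have h1 := hR c b (hs c hcs).1 (hs c hcs).2
    dsimp only at h1
    rw [hLc] at h1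
    exact lt_irrefl _ h1
  rw [unbarredWordBefore, hbefore, unbarredEntries_append, unbarredEntries_append, content_append,
    content_append, content_left h, ← add_assoc, Pi.add_apply, h0, add_zero,
    content_rightColumns hR]

/-! ### The structure coefficients -/

open Classical in
/-- The partition with parts `α`, if `α` is weakly decreasing. -/
noncomputable def toPartition (α : Fin d → ℕ) : DPartition d :=
  if h : Antitone α then ⟨α, h⟩ else ⟨0, antitone_zero_function⟩

theorem toPartition_val {α : Fin d → ℕ} (h : Antitone α) : (toPartition α).1 = α := by
  rw [toPartition, dif_pos h]

theorem IsDominantTableau.antitone {B : Cell μ → Fin d × Bool}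
    (hB : IsDominantTableau lam.1 B) :
    Antitone (cumContent lam.1 (unbarSet B) (numColumns μ)) := by
  rcases h : numColumns μ with _ | n
  · rw [cumContent_zero]
    exact lam.2
  · exact hB.2 n (by omega)

open Classical in
/-- The sum of the weights of the barred tableaux with unbarred content `ν`, as a family indexed by
`ν`. -/
noncomputable def tableauCoeff (lam μ : DPartition d) : DPartition d →₀ YRing :=
  ∑ B : Cell μ → Fin d × Bool with IsDominantTableau lam.1 B,
    Finsupp.single (toPartition (cumContent lam.1 (unbarSet B) (numColumns μ)))
      (tableauWeight lam.1 B)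

theorem tableauCoeff_sum {M : Type*} [AddCommMonoid M] [Module YRing M]
    (f : DPartition d → M) : (tableauCoeff lam μ).sum (fun ν a => a • f ν) =
      open Classical in
      ∑ B : Cell μ → Fin d × Bool with IsDominantTableau lam.1 B, tableauWeight lam.1 B •
        f (toPartition (cumContent lam.1 (unbarSet B) (numColumns μ))) := by
  rw [tableauCoeff, ← Finsupp.sum_finsetSum_index (h := fun ν a => a • f ν) (fun _ => zero_smul _ _)
    (fun _ _ _ => add_smul _ _ _)]
  refine Finset.sum_congr rfl fun B _ => ?_
  exact Finsupp.sum_single_index (zero_smul _ _)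

theorem isProductExpansion_tableauCoeff (lam μ : DPartition d) :
    IsProductExpansion lam μ (tableauCoeff lam μ) := by
  classical
  refine mul_left_cancel₀ (alternate_staircase_ne_zero (d := d)) ?_
  rw [← mul_assoc, alternate_staircase_mul_factorialSchur, alternate_mul_factorialSchur,
    tableauCoeff_sum, Finset.mul_sum]
  refine Finset.sum_congr rfl fun B hB => ?_
  -- Dominance makes every final content a partition, so the default value of `toPartition` never
  -- enters.
  rw [mul_smul_comm, alternate_staircase_mul_factorialSchur,
    toPartition_val (Finset.mem_filter.1 hB).2.antitone]

/-- Multiplication by a_δ turns a combination of factorial Schur functions into the same combination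
of alternants, which are linearly independent. -/
theorem IsProductExpansion.unique {c c' : DPartition d →₀ YRing} (hc : IsProductExpansion lam μ c)
    (hc' : IsProductExpansion lam μ c') : c = c' := by
  rw [← sub_eq_zero]
  apply alternant_coeff_eq_zero
  rw [Finsupp.sum_sub_index fun _ _ _ => sub_smul _ _ _, sub_eq_zero]
  have key : ∀ e : DPartition d →₀ YRing,
      (e.sum fun ν a => a • alternate d (facMono (ν.1 + staircase d))) =
        alternate d (facMono (staircase d)) * e.sum fun ν a => a • factorialSchur ν := by
    intro e
    rw [Finsupp.sum, Finsupp.sum, Finset.mul_sum]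
    refine Finset.sum_congr rfl fun ν _ => ?_
    rw [mul_smul_comm, alternate_staircase_mul_factorialSchur]
  rw [key, key, ← hc, ← hc']

-- Restriction to the boxes of μ is a bijection: the inverse fills λ with row numbers, the only
-- filling allowed there.
open Classical in
theorem tableauCoeff_apply (lam μ ν : DPartition d) :
    tableauCoeff lam μ ν = ∑ L : Filling lam μ with IsEquivariantLR ν L, weight L := by
  rw [tableauCoeff, Finsupp.finsetSum_apply]
  simp only [Finsupp.single_apply]
  rw [← Finset.sum_filter, Finset.filter_filter]
  refine Finset.sum_bij (fun B _ => Sum.elim (fun b => (b.1, false)) B) ?_ ?_ ?_ ?_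
  · intro B hB
    obtain ⟨-, hB, hν⟩ := Finset.mem_filter.1 hB
    rw [Finset.mem_filter, isEquivariantLR_iff]
    exact ⟨Finset.mem_univ _, fun _ => rfl, hB, by rw [← hν, toPartition_val hB.antitone]; rfl⟩
  · intro B _ B' _ h
    funext b
    exact congrFun h (Sum.inr b)
  · intro L hL
    rw [Finset.mem_filter, isEquivariantLR_iff] at hL
    obtain ⟨-, h1, hB, hν⟩ := hL
    refine ⟨fun b => L (Sum.inr b), ?_, ?_⟩
    · rw [Finset.mem_filter]
      exact ⟨Finset.mem_univ _, hB, Subtype.ext ((toPartition_val hB.antitone).trans hν)⟩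
    · funext x
      rcases x with b | b
      · exact (h1 b).symm
      · rfl
  · intro B hB
    obtain ⟨-, hB, -⟩ := Finset.mem_filter.1 hB
    exact (weight_eq (L := Sum.elim (fun b : Cell lam => (b.1, false)) B) (fun _ => rfl)
      hB.1.colStrict).symm

end FactorialSchur

open FactorialSchur in
open Classical in
theorem theorem2p1 (d : ℕ) (hd : 0 < d) (lam μ : DPartition d) :
    (∃! c : DPartition d →₀ YRing, IsProductExpansion lam μ c) ∧
    ∀ c : DPartition d →₀ YRing, IsProductExpansion lam μ c →
      ∀ ν : DPartition d, c ν = ∑ L : Filling lam μ with IsEquivariantLR ν L, weight L := by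
  refine ⟨⟨tableauCoeff lam μ, isProductExpansion_tableauCoeff lam μ, fun c hc =>
    hc.unique (isProductExpansion_tableauCoeff lam μ)⟩, fun c hc ν => ?_⟩
  rw [hc.unique (isProductExpansion_tableauCoeff lam μ), tableauCoeff_apply]
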